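/- There is an absolute constant $C$ such that the following holds. Let $G=(V,E)$ be a finite simple graph with maximum degree $\Delta\ge 2$ and minimum degree $\delta\ge C\log\Delta$, where $\log$ is the natural logarithm. Then there is a map $\omega:E\to\{1,2,3\}$ such that, writing $s(v)=\sum_{e\in E,\ v\in e}\omega(e)$ for the weighted degree of a vertex $v$ (the sum of the weights of all edges incident with $v$), $s(u)\neq s(v)$ for every edge $uv\in E$. -/

import Mathlib

namespace SimpleGraph

/-- A `k`-weighting of `G`: a map from the edge set of `G` to `{1, 2, …, k}`. -/
def IsWeighting {V : Type*} (G : SimpleGraph V) (k : ℕ) (ω : G.edgeSet → ℕ) : Prop :=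
  ∀ e : G.edgeSet, 1 ≤ ω e ∧ ω e ≤ k

/-- The weighted degree of `v`: the sum of the weights of the edges of `G` incident with `v`. -/
def weightedDegree {V : Type*} [Fintype V] [DecidableEq V] (G : SimpleGraph V)
    [DecidableRel G.Adj] (ω : G.edgeSet → ℕ) (v : V) : ℕ :=
  ∑ e : G.edgeSet with v ∈ e.val, ω e

/-- An edge weighting is vertex-colouring if adjacent vertices have distinct weighted degrees. -/
def IsVertexColouring {V : Type*} [Fintype V] [DecidableEq V] (G : SimpleGraph V)
    [DecidableRel G.Adj] (ω : G.edgeSet → ℕ) : Prop :=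
  ∀ u v : V, G.Adj u v → G.weightedDegree ω u ≠ G.weightedDegree ω v

end SimpleGraph

/-! Give every vertex an independent uniform label: a position `x < N` and a class from 0 to 4. An
edge that avoids classes 0 and 1 starts with weight 3 or 1, according to whether the positions of
its ends add up to at least `N`; every other edge starts with 2. Outside classes 0 and 1, the
expected sum at a vertex of degree d is nearly d(1 + 2x/N), so expected sums are spread evenly over
an interval of length about 2d. By Chernoff's bound and the local lemma, where δ ≥ C log Δ beats the
Δ² dependencies, some labelling has all the required neighbourhood statistics close to their means
(`exists_labelling_concentrated`).

The rest is deterministic (`exists_weighting_of_classes`). The integers are cut into blocks, whose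
length L is a small fraction of d. At most about L/2 neighbours of degree at least d have their
expected sum in the block of a given vertex, while 5L/8 integers of the block are 3, ..., 7 modulo
8. Greedy colouring by decreasing degree therefore gives class 4 distinct targets with these
residues. Classes 2 and 3 hold 1/8 of the labels, hence about L/16 competitors, and the L/8
multiples of 8 suffice for them. Targets are reached by shifting weight-2 edges towards classes 0
and 1 by one.

Finally, classes 0 and 1 obtain sums that are 2 modulo 8 by shifting edges towards helpers of
classes 3 and 2, so that each helper's sum grows by 0 or 1 (`exists_toggling`). The residues 2, {0,
1} and {3, ..., 7} separate the three groups; inside a group the greedy choices do. No edge is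
shifted twice, so weights stay in {1, 2, 3}. -/

open Finset

/-! ### Probabilistic tools: independence, local lemma, concentration -/

/-- Events depending on disjoint sets of coordinates of a uniform function are independent. -/
theorem card_inter_mul_card_of_disjoint_support {V α : Type*} [Fintype V] [DecidableEq V]
    [Fintype α] [DecidableEq α] (E F : Finset (V → α)) (S T : Finset V) (hST : Disjoint S T)
    (hE : ∀ f g : V → α, (∀ x ∈ S, f x = g x) → f ∈ E → g ∈ E)
    (hF : ∀ f g : V → α, (∀ x ∈ T, f x = g x) → f ∈ F → g ∈ F) :
    #(E ∩ F) * Fintype.card (V → α) = #E * #F := by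
  classical
  rw [← Finset.card_univ, ← Finset.card_product, ← Finset.card_product]
  have hT : ∀ x ∈ T, x ∉ S := fun x hx hx' => Finset.disjoint_left.1 hST hx' hx
  -- Exchanging the coordinates of two functions outside `S` is an involution that carries `(E ∩ F)
  -- ×ˢ univ` to `E ×ˢ F`.
  let ψ : (V → α) × (V → α) → (V → α) × (V → α) := fun p =>
    (S.piecewise p.1 p.2, S.piecewise p.2 p.1)
  have hψ : ∀ p, ψ (ψ p) = p := by
    rintro ⟨f, g⟩
    ext x <;> by_cases hx : x ∈ S <;> simp [ψ, hx]
  refine Finset.card_nbij' ψ ψ ?_ ?_ (fun p _ => hψ p) (fun p _ => hψ p)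
  · rintro ⟨f, g⟩ h
    simp only [coe_product, coe_inter, coe_univ, Set.mem_prod, Set.mem_inter_iff, mem_coe,
      Set.mem_univ, and_true] at h ⊢
    refine ⟨hE f _ (fun x hx => ?_) h.1, hF f _ (fun x hx => ?_) h.2⟩
    · simp [ψ, hx]
    · simp [ψ, hT x hx]
  · rintro ⟨f, g⟩ h
    simp only [coe_product, coe_inter, coe_univ, Set.mem_prod, Set.mem_inter_iff, mem_coe,
      Set.mem_univ, and_true] at h ⊢
    refine ⟨hE f _ (fun x hx => ?_) h.1, hF g _ (fun x hx => ?_) h.2⟩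
    · simp [ψ, hx]
    · simp [ψ, hT x hx]

/-- The symmetric Lovász Local Lemma for uniform random functions. -/
theorem exists_forall_notMem_of_local {ι V α : Type*} [Fintype ι] [Fintype V]
    [DecidableEq V] [Fintype α] [DecidableEq α] [Nonempty α] (E : ι → Finset (V → α))
    (S : ι → Finset V)
    (hE : ∀ i, ∀ f g : V → α, (∀ x ∈ S i, f x = g x) → f ∈ E i → g ∈ E i)
    (p : ℝ) (hp0 : 0 ≤ p) (hp : ∀ i, (#(E i) : ℝ) ≤ p * Fintype.card (V → α))
    (D : ℕ) (hD1 : 1 ≤ D) (hD : ∀ i, #{j | ¬ Disjoint (S i) (S j)} ≤ D) (hpD : 4 * p * D ≤ 1) :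
    ∃ f : V → α, ∀ i, f ∉ E i := by
  classical
  let Γ : Finset ι → Finset (V → α) := fun s => {f | ∀ j ∈ s, f ∉ E j}
  have hΓ : ∀ s f, f ∈ Γ s ↔ ∀ j ∈ s, f ∉ E j := fun s f => by simp [Γ]
  have hN : (0 : ℝ) < Fintype.card (V → α) := by exact_mod_cast Fintype.card_pos
  have hp4 : p ≤ 1 / 4 := by
    have : (1 : ℝ) ≤ D := by exact_mod_cast hD1
    nlinarith
  -- Conditionally on avoiding the events of `s`, each event has probability at most `2 * p`. Strong
  -- induction is needed because the bound is reused for the smaller set `s₂`.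
  have key : ∀ (n : ℕ) (s : Finset ι), #s = n → ∀ i,
      (#(E i ∩ Γ s) : ℝ) ≤ 2 * p * #(Γ s) := by
    intro n
    induction n using Nat.strong_induction_on with
    | _ n ih =>
      intro s hs i
      set s₁ := s.filter fun j => ¬ Disjoint (S i) (S j) with hs₁
      set s₂ := s.filter fun j => Disjoint (S i) (S j) with hs₂
      have hind : (#(E i ∩ Γ s₂) : ℝ) ≤ p * #(Γ s₂) := by
        have h := card_inter_mul_card_of_disjoint_support (E i) (Γ s₂) (S i)
          (s₂.biUnion S) (by
            rw [Finset.disjoint_biUnion_right]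
            intro j hj
            exact (Finset.mem_filter.1 hj).2) (hE i) (by
            intro f g hfg hf
            rw [hΓ] at hf ⊢
            intro j hj hg
            refine hf j hj (hE j g f (fun x hx => (hfg x ?_).symm) hg)
            exact Finset.mem_biUnion.2 ⟨j, hj, hx⟩)
        have h' : (#(E i ∩ Γ s₂) : ℝ) * Fintype.card (V → α) = #(E i) * #(Γ s₂) := by
          exact_mod_cast h
        have h2 := mul_le_mul_of_nonneg_right (hp i) (Nat.cast_nonneg (α := ℝ) (#(Γ s₂)))
        rw [← h'] at h2
        have h3 : (#(E i ∩ Γ s₂) : ℝ) * Fintype.card (V → α)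
            ≤ (p * #(Γ s₂)) * Fintype.card (V → α) := by linarith
        exact le_of_mul_le_mul_right h3 hN
      have hsub : Γ s ⊆ Γ s₂ := by
        intro f hf
        rw [hΓ] at hf ⊢
        exact fun j hj => hf j (Finset.mem_filter.1 hj).1
      have hle : (#(E i ∩ Γ s) : ℝ) ≤ #(E i ∩ Γ s₂) := by
        exact_mod_cast Finset.card_le_card (Finset.inter_subset_inter_left hsub)
      -- Given `Γ s₂`, the at most `D` events of `s₁` have total probability at most `2 * p * D ≤ 1
      -- / 2`.
      have hhalf : (#(Γ s₂) : ℝ) ≤ 2 * #(Γ s) := by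
        by_cases hemp : s₁ = ∅
        · have : s₂ = s := by
            rw [hs₂, Finset.filter_eq_self]
            intro j hj
            by_contra hcon
            have : j ∈ s₁ := Finset.mem_filter.2 ⟨hj, hcon⟩
            simp [hemp] at this
          rw [this]
          have : (0 : ℝ) ≤ #(Γ s) := Nat.cast_nonneg _
          linarith
        · have hlt : #s₂ < n := by
            rw [← hs]
            apply Finset.card_lt_card
            refine ⟨Finset.filter_subset _ _, fun hss => hemp ?_⟩
            rw [Finset.eq_empty_iff_forall_notMem]
            intro j hj
            exact (Finset.mem_filter.1 hj).2
              (Finset.mem_filter.1 (hss (Finset.mem_filter.1 hj).1)).2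
          have hcov : Γ s₂ ⊆ Γ s ∪ s₁.biUnion fun j => E j ∩ Γ s₂ := by
            intro f hf
            by_cases hfs : f ∈ Γ s
            · exact Finset.mem_union_left _ hfs
            · apply Finset.mem_union_right
              rw [hΓ] at hfs
              push Not at hfs
              obtain ⟨j, hj, hfj⟩ := hfs
              refine Finset.mem_biUnion.2 ⟨j, Finset.mem_filter.2 ⟨hj, fun hd => ?_⟩,
                Finset.mem_inter.2 ⟨hfj, hf⟩⟩
              exact (hΓ _ _).1 hf j (Finset.mem_filter.2 ⟨hj, hd⟩) hfj
          have hc : #(Γ s₂) ≤ #(Γ s) + ∑ j ∈ s₁, #(E j ∩ Γ s₂) :=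
            (Finset.card_le_card hcov).trans ((Finset.card_union_le _ _).trans
              (Nat.add_le_add_left Finset.card_biUnion_le _))
          have hc' : (#(Γ s₂) : ℝ) ≤ #(Γ s) + ∑ j ∈ s₁, (#(E j ∩ Γ s₂) : ℝ) := by
            exact_mod_cast hc
          have hsum : ∑ j ∈ s₁, (#(E j ∩ Γ s₂) : ℝ) ≤ #s₁ * (2 * p * #(Γ s₂)) := by
            rw [← nsmul_eq_mul]
            exact Finset.sum_le_card_nsmul _ _ _ fun j _ => ih _ hlt s₂ rfl j
          have hs₁D : (#s₁ : ℝ) ≤ D := by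
            have : #s₁ ≤ D := (Finset.card_le_card (by
              intro j hj
              simpa using (Finset.mem_filter.1 hj).2)).trans (hD i)
            exact_mod_cast this
          have h0 : (0 : ℝ) ≤ 2 * p * #(Γ s₂) := by positivity
          have h1 : (#s₁ : ℝ) * (2 * p * #(Γ s₂)) ≤ D * (2 * p * #(Γ s₂)) :=
            mul_le_mul_of_nonneg_right hs₁D h0
          have h2 : (4 * p * D) * (#(Γ s₂) : ℝ) ≤ 1 * #(Γ s₂) :=
            mul_le_mul_of_nonneg_right hpD (Nat.cast_nonneg _)
          nlinarith
      calc (#(E i ∩ Γ s) : ℝ) ≤ p * #(Γ s₂) := hle.trans hind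
        _ ≤ p * (2 * #(Γ s)) := mul_le_mul_of_nonneg_left hhalf hp0
        _ = 2 * p * #(Γ s) := by ring
  have hpos : ∀ s : Finset ι, (0 : ℝ) < #(Γ s) := by
    intro s
    induction s using Finset.induction_on with
    | empty =>
      have : Γ ∅ = univ := by ext f; simp [hΓ]
      rw [this, Finset.card_univ]
      exact hN
    | insert i s _ ih =>
      have hcov : Γ s ⊆ Γ (insert i s) ∪ (E i ∩ Γ s) := by
        intro f hf
        by_cases hfi : f ∈ E i
        · exact Finset.mem_union_right _ (Finset.mem_inter.2 ⟨hfi, hf⟩)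
        · apply Finset.mem_union_left
          rw [hΓ] at hf ⊢
          intro j hj
          rcases Finset.mem_insert.1 hj with rfl | hj
          · exact hfi
          · exact hf j hj
      have hc : (#(Γ s) : ℝ) ≤ #(Γ (insert i s)) + #(E i ∩ Γ s) := by
        exact_mod_cast (Finset.card_le_card hcov).trans (Finset.card_union_le _ _)
      have := key _ s rfl i
      nlinarith
  have hne : (Γ univ).Nonempty := by
    rw [← Finset.card_pos]
    exact_mod_cast hpos univ
  obtain ⟨f, hf⟩ := hne
  exact ⟨f, fun i => (hΓ _ _).1 hf i (Finset.mem_univ i)⟩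

/-- A Chernoff bound for sums of independent centred variables bounded by `1`. -/
theorem card_sum_gt_le_exp {V α : Type*} [Fintype V] [DecidableEq V] [Fintype α]
    [Nonempty α] (f : V → α → ℝ) (hf : ∀ u a, |f u a| ≤ 1)
    (hmean : ∀ u, ∑ a, f u a = 0) (T : Finset V) (ρ : ℝ) (hρ0 : 0 < ρ) (hρ1 : ρ ≤ 1) :
    (#{φ : V → α | ρ * #T < ∑ u ∈ T, f u (φ u)} : ℝ)
      ≤ Real.exp (-(ρ ^ 2 / 4 * #T)) * Fintype.card (V → α) := by
  classical
  -- Exponential moment at parameter `ρ / 2`, from e^x ≤ 1 + x + x² for |x| ≤ 1; the linear term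
  -- averages to zero.
  have hone : ∀ u, ∑ a, Real.exp (ρ / 2 * f u a) ≤ Fintype.card α * Real.exp (ρ ^ 2 / 4) := by
    intro u
    have h1 : ∀ a, Real.exp (ρ / 2 * f u a) ≤ 1 + ρ / 2 * f u a + ρ ^ 2 / 4 := by
      intro a
      have hb := hf u a
      have habs : |ρ / 2 * f u a| ≤ 1 := by
        rw [abs_mul, abs_of_pos (by positivity)]
        nlinarith [abs_nonneg (f u a)]
      have h2 := (abs_le.1 (Real.abs_exp_sub_one_sub_id_le habs)).2
      have h3 : (f u a) ^ 2 ≤ 1 := by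
        rw [← sq_abs]
        nlinarith [abs_nonneg (f u a)]
      nlinarith [sq_nonneg ρ]
    calc ∑ a, Real.exp (ρ / 2 * f u a)
        ≤ ∑ a, (1 + ρ / 2 * f u a + ρ ^ 2 / 4) := Finset.sum_le_sum fun a _ => h1 a
      _ = Fintype.card α * (1 + ρ ^ 2 / 4) := by
          simp only [Finset.sum_add_distrib, ← Finset.mul_sum, hmean u]
          simp
          ring
      _ ≤ Fintype.card α * Real.exp (ρ ^ 2 / 4) := by
          gcongr
          linarith [Real.add_one_le_exp (ρ ^ 2 / 4)]
  have hmgf : ∑ φ : V → α, Real.exp (ρ / 2 * ∑ u ∈ T, f u (φ u))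
      ≤ Real.exp (ρ ^ 2 / 4 * #T) * Fintype.card (V → α) := by
    have e1 : ∀ φ : V → α, Real.exp (ρ / 2 * ∑ u ∈ T, f u (φ u))
        = ∏ u, (if u ∈ T then Real.exp (ρ / 2 * f u (φ u)) else 1) := by
      intro φ
      rw [Finset.mul_sum, Real.exp_sum, Finset.prod_ite_mem, Finset.univ_inter]
    have e2 : ∑ φ : V → α, ∏ u, (if u ∈ T then Real.exp (ρ / 2 * f u (φ u)) else 1)
        = ∏ u, ∑ a, (if u ∈ T then Real.exp (ρ / 2 * f u a) else 1) := by
      rw [Finset.prod_univ_sum, Fintype.piFinset_univ]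
    simp only [e1, e2]
    calc ∏ u, ∑ a, (if u ∈ T then Real.exp (ρ / 2 * f u a) else 1)
        ≤ ∏ u : V, ((Fintype.card α : ℝ) * (if u ∈ T then Real.exp (ρ ^ 2 / 4) else 1)) := by
          apply Finset.prod_le_prod
          · intro u _
            apply Finset.sum_nonneg
            intro a _
            split_ifs <;> positivity
          · intro u _
            split_ifs with hu
            · exact hone u
            · simp
      _ = Real.exp (ρ ^ 2 / 4 * #T) * Fintype.card (V → α) := by
          rw [Finset.prod_mul_distrib, Finset.prod_ite_mem, Finset.univ_inter,
            Finset.prod_const, Finset.prod_const, ← Real.exp_nat_mul, Finset.card_univ,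
            Fintype.card_fun]
          push_cast
          ring_nf
  -- Markov's inequality: the threshold contributes `ρ ^ 2 / 2` per vertex and the moment bound
  -- costs `ρ ^ 2 / 4`, which leaves `ρ ^ 2 / 4`.
  have hmark : (#{φ : V → α | ρ * #T < ∑ u ∈ T, f u (φ u)} : ℝ) * Real.exp (ρ ^ 2 / 2 * #T)
      ≤ ∑ φ : V → α, Real.exp (ρ / 2 * ∑ u ∈ T, f u (φ u)) := by
    rw [← nsmul_eq_mul]
    refine (Finset.card_nsmul_le_sum _ _ _ ?_).trans
      (Finset.sum_le_univ_sum_of_nonneg fun φ => (Real.exp_pos _).le)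
    intro φ hφ
    have hφ' := (Finset.mem_filter.1 hφ).2
    apply Real.exp_le_exp.2
    nlinarith
  have hfin := hmark.trans hmgf
  have e3 : Real.exp (ρ ^ 2 / 4 * #T)
      = Real.exp (-(ρ ^ 2 / 4 * #T)) * Real.exp (ρ ^ 2 / 2 * #T) := by
    rw [← Real.exp_add]
    ring_nf
  rw [e3] at hfin
  have hpos := Real.exp_pos (ρ ^ 2 / 2 * (#T : ℝ))
  refine le_of_mul_le_mul_right ?_ hpos
  linarith

/-- In a graph whose minimum degree is large compared with the logarithm of its maximum degree,
the vertices can be labelled so that all prescribed local statistics are close to their means. -/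
theorem exists_labelling_concentrated (κ α : Type) [Fintype κ] [Nonempty κ] [Fintype α]
    [Nonempty α] (ρ : ℝ) (hρ0 : 0 < ρ) (hρ1 : ρ ≤ 1) :
    ∃ C : ℝ, ∀ (V : Type*) [Fintype V] [DecidableEq V] (G : SimpleGraph V) [DecidableRel G.Adj],
      2 ≤ G.maxDegree → C * Real.log G.maxDegree ≤ G.minDegree →
      ∀ g : V → κ → V → α → ℝ, (∀ v k u a, 0 ≤ g v k u a) → (∀ v k u a, g v k u a ≤ 1) →
      ∃ Z : V → α, ∀ v k,
        |∑ u ∈ G.neighborFinset v, g v k u (Z u)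
          - ∑ u ∈ G.neighborFinset v, (∑ a, g v k u a) / Fintype.card α| ≤ ρ * G.degree v := by
  classical
  set K : ℝ := 8 * Fintype.card κ with hK
  have hκ : (1 : ℝ) ≤ Fintype.card κ := by exact_mod_cast Fintype.card_pos
  have hK1 : 8 ≤ K := by rw [hK]; linarith
  have hl2 : 0 < Real.log 2 := Real.log_pos (by norm_num)
  have hlK : 0 ≤ Real.log K := Real.log_nonneg (by linarith)
  -- Chosen so that `ρ ^ 2 / 4 * δ ≥ 2 * log Δ + log K`, using `log Δ ≥ log 2` to absorb `log K`.
  -- This is the local lemma condition with `p = 2 * |κ| * q` (two tails per statistic) and `D = Δ ^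
  -- 2`, whence `K = 8 * |κ|`.
  refine ⟨4 / ρ ^ 2 * (2 + Real.log K / Real.log 2), ?_⟩
  intro V _ _ G _ hΔ hδ g hg0 hg1
  have hcα : (0 : ℝ) < Fintype.card α := by exact_mod_cast Fintype.card_pos
  let m : V → κ → V → ℝ := fun v k u => (∑ a, g v k u a) / Fintype.card α
  have hm0 : ∀ v k u, 0 ≤ m v k u := fun v k u =>
    div_nonneg (Finset.sum_nonneg fun a _ => hg0 v k u a) hcα.le
  have hm1 : ∀ v k u, m v k u ≤ 1 := by
    intro v k u
    rw [div_le_one hcα]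
    calc ∑ a, g v k u a ≤ ∑ a : α, (1 : ℝ) := Finset.sum_le_sum fun a _ => hg1 v k u a
      _ = Fintype.card α := by simp
  let U : V → κ → Finset (V → α) := fun v k =>
    {φ | ρ * #(G.neighborFinset v) < ∑ u ∈ G.neighborFinset v, (g v k u (φ u) - m v k u)}
  let W : V → κ → Finset (V → α) := fun v k =>
    {φ | ρ * #(G.neighborFinset v) < ∑ u ∈ G.neighborFinset v, (m v k u - g v k u (φ u))}
  let E : V → Finset (V → α) := fun v => univ.biUnion fun k => U v k ∪ W v k
  have hmE : ∀ v k u, ∑ a, (g v k u a - m v k u) = 0 := by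
    intro v k u
    simp only [Finset.sum_sub_distrib, Finset.sum_const, Finset.card_univ, nsmul_eq_mul, m]
    field_simp
    ring
  have hΔ' : (2 : ℝ) ≤ G.maxDegree := by exact_mod_cast hΔ
  have hlogΔ : Real.log 2 ≤ Real.log G.maxDegree := Real.log_le_log (by norm_num) hΔ'
  set q : ℝ := Real.exp (-(ρ ^ 2 / 4 * G.minDegree)) with hq
  have hq0 : 0 < q := Real.exp_pos _
  have hqK : K * q * (G.maxDegree : ℝ) ^ 2 ≤ 1 := by
    have h1 : 2 * Real.log G.maxDegree + Real.log K ≤ ρ ^ 2 / 4 * G.minDegree := by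
      have h2 : ρ ^ 2 / 4 * (4 / ρ ^ 2 * (2 + Real.log K / Real.log 2) * Real.log G.maxDegree)
          ≤ ρ ^ 2 / 4 * G.minDegree := by gcongr
      have h3 : ρ ^ 2 / 4 * (4 / ρ ^ 2 * (2 + Real.log K / Real.log 2) * Real.log G.maxDegree)
          = 2 * Real.log G.maxDegree + Real.log K * (Real.log G.maxDegree / Real.log 2) := by
        field_simp
      have h4 : 1 ≤ Real.log G.maxDegree / Real.log 2 := by rwa [one_le_div hl2]
      nlinarith
    have h5 : K * (G.maxDegree : ℝ) ^ 2
        = Real.exp (2 * Real.log G.maxDegree + Real.log K) := by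
      rw [Real.exp_add, Real.exp_log (by linarith), two_mul, Real.exp_add,
        Real.exp_log (by linarith)]
      ring
    calc K * q * (G.maxDegree : ℝ) ^ 2 = (K * (G.maxDegree : ℝ) ^ 2) * q := by ring
      _ = Real.exp (2 * Real.log G.maxDegree + Real.log K + -(ρ ^ 2 / 4 * G.minDegree)) := by
          rw [h5, hq, ← Real.exp_add]
      _ ≤ 1 := Real.exp_le_one_iff.2 (by linarith)
  have hcard : ∀ v (f : V → α → ℝ), (∀ u a, |f u a| ≤ 1) → (∀ u, ∑ a, f u a = 0) →
      (#{φ : V → α | ρ * #(G.neighborFinset v) < ∑ u ∈ G.neighborFinset v, f u (φ u)} : ℝ)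
        ≤ q * Fintype.card (V → α) := by
    intro v f hf hf0
    refine (card_sum_gt_le_exp f hf hf0 _ ρ hρ0 hρ1).trans ?_
    gcongr
    rw [hq]
    apply Real.exp_le_exp.2
    have : (G.minDegree : ℝ) ≤ #(G.neighborFinset v) := by
      rw [G.card_neighborFinset_eq_degree]
      exact_mod_cast G.minDegree_le_degree v
    have : ρ ^ 2 / 4 * (G.minDegree : ℝ) ≤ ρ ^ 2 / 4 * #(G.neighborFinset v) := by gcongr
    linarith
  obtain ⟨Z, hZ⟩ := exists_forall_notMem_of_local E (fun v => G.neighborFinset v) (by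
      intro v φ ψ hφψ hφ
      obtain ⟨k, -, hk⟩ := Finset.mem_biUnion.1 hφ
      refine Finset.mem_biUnion.2 ⟨k, Finset.mem_univ _, ?_⟩
      rcases Finset.mem_union.1 hk with hk | hk
      · refine Finset.mem_union_left _ (Finset.mem_filter.2 ⟨Finset.mem_univ _, ?_⟩)
        refine (Finset.mem_filter.1 hk).2.trans_eq (Finset.sum_congr rfl fun u hu => ?_)
        rw [hφψ u hu]
      · refine Finset.mem_union_right _ (Finset.mem_filter.2 ⟨Finset.mem_univ _, ?_⟩)
        refine (Finset.mem_filter.1 hk).2.trans_eq (Finset.sum_congr rfl fun u hu => ?_)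
        rw [hφψ u hu])
    (2 * Fintype.card κ * q) (by positivity) (by
      intro v
      have h1 : #(E v) ≤ ∑ k : κ, (#(U v k) + #(W v k)) :=
        Finset.card_biUnion_le.trans (Finset.sum_le_sum fun k _ => Finset.card_union_le _ _)
      have h2 : (#(E v) : ℝ) ≤ ∑ k : κ, ((#(U v k) : ℝ) + #(W v k)) := by exact_mod_cast h1
      refine h2.trans ?_
      have h3 : ∀ k ∈ (univ : Finset κ), ((#(U v k) : ℝ) + #(W v k))
          ≤ 2 * q * Fintype.card (V → α) := by
        intro k _
        have hu := hcard v (fun u a => g v k u a - m v k u) (by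
          intro u a
          rw [abs_le]
          constructor <;> linarith [hg0 v k u a, hg1 v k u a, hm0 v k u, hm1 v k u])
          (hmE v k)
        have hw := hcard v (fun u a => m v k u - g v k u a) (by
          intro u a
          rw [abs_le]
          constructor <;> linarith [hg0 v k u a, hg1 v k u a, hm0 v k u, hm1 v k u])
          (by
            intro u
            rw [← neg_eq_zero, ← Finset.sum_neg_distrib, ← hmE v k u]
            exact Finset.sum_congr rfl fun a _ => by ring)
        change (#(U v k) : ℝ) ≤ _ at hu
        change (#(W v k) : ℝ) ≤ _ at hw
        linarith
      refine (Finset.sum_le_card_nsmul _ _ _ h3).trans_eq ?_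
      rw [nsmul_eq_mul, Finset.card_univ]
      ring)
    (G.maxDegree ^ 2) (Nat.one_le_pow _ _ (by omega)) (by
      intro v
      have hsub : (univ.filter fun w => ¬ Disjoint (G.neighborFinset v) (G.neighborFinset w))
          ⊆ (G.neighborFinset v).biUnion fun u => G.neighborFinset u := by
        intro w hw
        obtain ⟨u, hu, hu'⟩ := Finset.not_disjoint_iff.1 (Finset.mem_filter.1 hw).2
        refine Finset.mem_biUnion.2 ⟨u, hu, ?_⟩
        rw [SimpleGraph.mem_neighborFinset] at hu' ⊢
        exact hu'.symm
      refine (Finset.card_le_card hsub).trans (Finset.card_biUnion_le.trans ?_)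
      refine (Finset.sum_le_card_nsmul _ _ G.maxDegree fun u _ => ?_).trans ?_
      · rw [G.card_neighborFinset_eq_degree]
        exact G.degree_le_maxDegree u
      · rw [smul_eq_mul, sq, G.card_neighborFinset_eq_degree]
        exact Nat.mul_le_mul_right _ (G.degree_le_maxDegree v))
    (by
      push_cast
      rw [hK] at hqK
      linarith)
  refine ⟨Z, fun v k => ?_⟩
  have hv := hZ v
  simp only [E, Finset.mem_biUnion, Finset.mem_univ, true_and, not_exists, Finset.mem_union,
    not_or] at hv
  obtain ⟨h1, h2⟩ := hv k
  simp only [U, W, Finset.mem_filter, Finset.mem_univ, true_and, not_lt,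
    G.card_neighborFinset_eq_degree, Finset.sum_sub_distrib] at h1 h2
  rw [abs_le]
  constructor <;> linarith

/-! ### Deterministic tools: greedy colouring and edge changes -/

/-- Greedy list colouring along a ranking: a vertex only competes with vertices of at least
its own rank. -/
theorem exists_list_colouring {V β : Type*} [Fintype V] [DecidableEq V] [DecidableEq β]
    (r : V → V → Prop) [DecidableRel r] (hr : ∀ u v, r u v → r v u) (rank : V → ℕ)
    (L : V → Finset β)
    (h : ∀ v, #{u | r v u ∧ rank v ≤ rank u} < #(L v)) :
    ∃ t : V → β, (∀ v, t v ∈ L v) ∧ ∀ u v, u ≠ v → r u v → t u ≠ t v := by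
  classical
  have hne : ∀ v, (L v).Nonempty := fun v => Finset.card_pos.1 ((Nat.zero_le _).trans_lt (h v))
  suffices H : ∀ s : Finset V, ∃ t : V → β, (∀ v, t v ∈ L v) ∧
      ∀ u ∈ s, ∀ v ∈ s, u ≠ v → r u v → t u ≠ t v by
    obtain ⟨t, h1, h2⟩ := H univ
    exact ⟨t, h1, fun u v => h2 u (mem_univ _) v (mem_univ _)⟩
  intro s
  -- The inserted vertex has least rank, so all its already coloured competitors are counted by `h`.
  induction s using Finset.induction_on_min_value rank with
  | empty => exact ⟨fun v => (hne v).choose, fun v => (hne v).choose_spec, by simp⟩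
  | insert a s ha hmin ih =>
    obtain ⟨t, ht1, ht2⟩ := ih
    have hlt : #((s.filter fun u => r a u).image t) < #(L a) := by
      refine Finset.card_image_le.trans_lt ((Finset.card_le_card ?_).trans_lt (h a))
      intro u hu
      rw [Finset.mem_filter] at hu ⊢
      exact ⟨mem_univ _, hu.2, hmin u hu.1⟩
    obtain ⟨c, hcL, hc⟩ := Finset.exists_mem_notMem_of_card_lt_card hlt
    have hc' : ∀ u ∈ s, r a u → t u ≠ c := by
      intro u hu hru heq
      exact hc (Finset.mem_image.2 ⟨u, Finset.mem_filter.2 ⟨hu, hru⟩, heq⟩)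
    refine ⟨Function.update t a c, ?_, ?_⟩
    · intro v
      by_cases hv : v = a
      · subst hv; simpa using hcL
      · simpa [hv] using ht1 v
    · intro u hu v hv huv hruv
      rcases Finset.mem_insert.1 hu with rfl | hu' <;>
        rcases Finset.mem_insert.1 hv with rfl | hv'
      · exact absurd rfl huv
      · rw [Function.update_self, Function.update_of_ne huv.symm]
        exact (hc' v hv' hruv).symm
      · rw [Function.update_self, Function.update_of_ne huv]
        exact hc' u hu' (hr _ _ hruv)
      · have hua : u ≠ a := fun h => ha (h ▸ hu')
        have hva : v ≠ a := fun h => ha (h ▸ hv')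
        rw [Function.update_of_ne hua, Function.update_of_ne hva]
        exact ht2 u hu' v hv' huv hruv

/-- Every integer between minus the number of negative signs and the number of positive signs
is the sum of some of the signs. -/
theorem exists_subset_sum_sign {ι : Type*} [DecidableEq ι] (T : Finset ι) (ε : ι → ℤ) (m : ℤ)
    (h1 : -(#{i ∈ T | ε i = -1} : ℤ) ≤ m) (h2 : m ≤ #{i ∈ T | ε i = 1}) :
    ∃ X ⊆ T, ∑ i ∈ X, ε i = m := by
  rcases le_total 0 m with hm | hm
  · obtain ⟨n, rfl⟩ := Int.eq_ofNat_of_zero_le hm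
    obtain ⟨X, hX, hc⟩ := Finset.exists_subset_card_eq (s := {i ∈ T | ε i = 1}) (n := n)
      (by exact_mod_cast h2)
    refine ⟨X, hX.trans (Finset.filter_subset _ _), ?_⟩
    rw [Finset.sum_congr rfl fun i hi => (Finset.mem_filter.1 (hX hi)).2]
    simp [hc]
  · obtain ⟨n, hn⟩ := Int.eq_ofNat_of_zero_le (neg_nonneg.2 hm)
    obtain ⟨X, hX, hc⟩ := Finset.exists_subset_card_eq (s := {i ∈ T | ε i = -1}) (n := n)
      (by omega)
    refine ⟨X, hX.trans (Finset.filter_subset _ _), ?_⟩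
    rw [Finset.sum_congr rfl fun i hi => (Finset.mem_filter.1 (hX hi)).2]
    simp [hc]
    omega

/-- An integer of absolute value at most `#T` is a sum of `#T` terms from `{-1, 0, 1}`. -/
theorem exists_unit_changes {ι : Type*} [DecidableEq ι] (T : Finset ι) (m : ℤ)
    (hm : |m| ≤ #T) :
    ∃ a : ι → ℤ, (∀ i, |a i| ≤ 1) ∧ (∀ i, i ∉ T → a i = 0) ∧ ∀ S, T ⊆ S → ∑ i ∈ S, a i = m := by
  obtain ⟨X, hX, hc⟩ := Finset.exists_subset_card_eq (s := T) (n := m.natAbs)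
    (by rw [Int.abs_eq_natAbs] at hm; exact_mod_cast hm)
  refine ⟨fun i => if i ∈ X then m.sign else 0, fun i => ?_, fun i hi => ?_, fun S hS => ?_⟩
  · dsimp only
    split_ifs
    · rcases lt_trichotomy m 0 with h | h | h
      · simp [Int.sign_eq_neg_one_of_neg h]
      · simp [h]
      · simp [Int.sign_eq_one_of_pos h]
    · simp
  · exact if_neg fun h => hi (hX h)
  · rw [Finset.sum_ite_mem, Finset.inter_eq_right.2 (hX.trans hS), Finset.sum_const, hc,
      nsmul_eq_mul, mul_comm]
    exact Int.sign_mul_natAbs m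

/-- The vertices of `Λ` are treated one after another. Each may change the edges towards its set
`B v` of helpers by one, so that every helper always has total change `0` or `1`; in this way
adjacent vertices of `Λ` get distinct values, all congruent to `2` modulo `8`. -/
theorem exists_toggling {V : Type*} [Fintype V] [DecidableEq V] (r : V → V → Prop)
    [DecidableRel r] (hr : ∀ u v, r u v → r v u) (Λ : Finset V) (B : V → Finset V) (s : V → ℤ)
    (h : ∀ v ∈ Λ, 8 * (#{u ∈ Λ | r v u} + 1) ≤ #(B v)) :
    ∃ τ : V → V → ℤ, (∀ u v, |τ u v| ≤ 1) ∧ (∀ u v, v ∉ Λ ∨ u ∉ B v → τ u v = 0) ∧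
      (∀ u, ∑ v, τ u v = 0 ∨ ∑ v, τ u v = 1) ∧
      (∀ v ∈ Λ, (s v + ∑ u, τ u v) % 8 = 2) ∧
      ∀ u ∈ Λ, ∀ v ∈ Λ, u ≠ v → r u v → s u + ∑ w, τ w u ≠ s v + ∑ w, τ w v := by
  classical
  suffices H : ∀ P ⊆ Λ, ∃ τ : V → V → ℤ, (∀ u v, |τ u v| ≤ 1) ∧
      (∀ u v, v ∉ P ∨ u ∉ B v → τ u v = 0) ∧
      (∀ u, ∑ v, τ u v = 0 ∨ ∑ v, τ u v = 1) ∧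
      (∀ v ∈ P, (s v + ∑ u, τ u v) % 8 = 2) ∧
      ∀ u ∈ P, ∀ v ∈ P, u ≠ v → r u v → s u + ∑ w, τ w u ≠ s v + ∑ w, τ w v from
    H Λ subset_rfl
  intro P
  induction P using Finset.induction_on with
  | empty => exact fun _ => ⟨fun _ _ => 0, by simp⟩
  | insert a P ha ih =>
    intro hP
    obtain ⟨τ, hτ1, hτ2, hτ3, hτ4, hτ5⟩ := ih ((Finset.subset_insert _ _).trans hP)
    have haΛ : a ∈ Λ := hP (Finset.mem_insert_self _ _)
    -- The only change a helper can still undergo while its total stays in {0, 1}: up from 0 or down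
    -- from 1.
    let ε : V → ℤ := fun u => if ∑ v, τ u v = 0 then 1 else -1
    have hε : ∀ u, ε u = 1 ∨ ε u = -1 := fun u => by
      dsimp only [ε]; split_ifs <;> simp
    set n₁ := #{i ∈ B a | ε i = 1} with hn₁
    set n₂ := #{i ∈ B a | ε i = -1} with hn₂
    have hn : n₁ + n₂ = #(B a) := by
      rw [hn₁, hn₂, ← Finset.card_union_of_disjoint]
      · rw [← Finset.filter_or, Finset.filter_true_of_mem fun u _ => hε u]
      · rw [Finset.disjoint_filter]
        intro u _ h1 h2
        omega
    set N := #{u ∈ Λ | r a u} with hN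
    have hB := h a haΛ
    -- The least reachable value that is 2 modulo 8. The reachable values fill an interval of length
    -- `n₁ + n₂ ≥ 8 * (N + 1)`, so `c, c + 8, ..., c + 8 * N` are all reachable: one more than the
    -- neighbours can forbid.
    set c := s a - n₂ + (2 - (s a - n₂)) % 8 with hc
    let cand : Finset ℤ := (Finset.range (N + 1)).image fun j : ℕ => c + 8 * (j : ℤ)
    have hcand : #cand = N + 1 := by
      rw [Finset.card_image_of_injective _ fun i j hij => by
        simpa using hij, Finset.card_range]
    let forb : Finset ℤ := ((P.filter fun u => r a u)).image fun u => s u + ∑ w, τ w u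
    have hforb : #forb < #cand := by
      rw [hcand]
      refine Nat.lt_succ_of_le (Finset.card_image_le.trans (Finset.card_le_card ?_))
      intro u hu
      rw [Finset.mem_filter] at hu ⊢
      exact ⟨hP (Finset.mem_insert_of_mem hu.1), hu.2⟩
    obtain ⟨x, hx, hxf⟩ := Finset.exists_mem_notMem_of_card_lt_card hforb
    obtain ⟨j, hj, hjx⟩ := Finset.mem_image.1 hx
    rw [Finset.mem_range] at hj
    obtain ⟨X, hXB, hXs⟩ := exists_subset_sum_sign (B a) ε (x - s a) (by omega) (by omega)
    have ha0 : ∀ u, τ u a = 0 := fun u => hτ2 u a (Or.inl ha)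
    let σ : V → V → ℤ := fun u v => if v = a then (if u ∈ X then ε u else 0) else τ u v
    have hσa : ∀ u, σ u a = if u ∈ X then ε u else 0 := fun u => by simp [σ]
    have hσ : ∀ u v, v ≠ a → σ u v = τ u v := fun u v hv => by simp [σ, hv]
    have hcol : ∑ u, σ u a = x - s a := by
      simp only [hσa]
      rw [Finset.sum_ite_mem, Finset.univ_inter, hXs]
    have hcol' : ∀ v, v ≠ a → ∑ u, σ u v = ∑ u, τ u v := fun v hv =>
      Finset.sum_congr rfl fun u _ => hσ u v hv
    have hrow : ∀ u, ∑ v, σ u v = ∑ v, τ u v + (if u ∈ X then ε u else 0) := by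
      intro u
      have : ∀ v, σ u v = τ u v + if v = a then (if u ∈ X then ε u else 0) else 0 := by
        intro v
        by_cases hv : v = a
        · subst hv; simp [hσa, ha0]
        · simp [hσ u v hv, hv]
      simp only [this, Finset.sum_add_distrib, Finset.sum_ite_eq', Finset.mem_univ, if_true]
    refine ⟨σ, ?_, ?_, ?_, ?_, ?_⟩
    · intro u v
      by_cases hv : v = a
      · subst hv
        rw [hσa]
        split_ifs
        · rcases hε u with h | h <;> simp [h]
        · simp
      · rw [hσ u v hv]; exact hτ1 u v
    · intro u v huv
      by_cases hv : v = a
      · subst hv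
        rw [hσa, if_neg]
        intro hu
        rcases huv with h | h
        · exact h (Finset.mem_insert_self _ _)
        · exact h (hXB hu)
      · rw [hσ u v hv]
        refine hτ2 u v (huv.imp_left fun h h' => h (Finset.mem_insert_of_mem h'))
    · intro u
      rw [hrow]
      by_cases hu : u ∈ X
      · rw [if_pos hu]
        rcases hτ3 u with h | h <;> simp [ε, h]
      · rw [if_neg hu, add_zero]
        exact hτ3 u
    · intro v hv
      rcases Finset.mem_insert.1 hv with rfl | hv
      · rw [hcol]; omega
      · rw [hcol' v (fun h => ha (h ▸ hv))]
        exact hτ4 v hv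
    · have hxP : ∀ u ∈ P, r a u → s u + ∑ w, τ w u ≠ x := fun u hu hru heq =>
        hxf (Finset.mem_image.2 ⟨u, Finset.mem_filter.2 ⟨hu, hru⟩, heq⟩)
      intro u hu v hv huv hruv
      rcases Finset.mem_insert.1 hu with rfl | hu' <;>
        rcases Finset.mem_insert.1 hv with rfl | hv'
      · exact absurd rfl huv
      · rw [hcol, hcol' v huv.symm]
        have := hxP v hv' hruv
        omega
      · rw [hcol, hcol' u huv]
        have := hxP u hu' (hr _ _ hruv)
        omega
      · rw [hcol' u (fun h => ha (h ▸ hu')), hcol' v (fun h => ha (h ▸ hv'))]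
        exact hτ5 u hu' v hv' huv hruv

/-- A symmetric integer function on pairs of vertices with values in `{1, 2, 3}` on the edges whose
vertex sums differ along edges gives a vertex-colouring `3`-weighting. -/
theorem exists_weighting_of_symm {V : Type*} [Fintype V] [DecidableEq V] (G : SimpleGraph V)
    [DecidableRel G.Adj] (w : V → V → ℤ) (hsymm : ∀ u v, w u v = w v u)
    (hw : ∀ u v, G.Adj u v → 1 ≤ w u v ∧ w u v ≤ 3)
    (hne : ∀ u v, G.Adj u v → ∑ x ∈ G.neighborFinset u, w u x ≠ ∑ x ∈ G.neighborFinset v, w v x) :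
    ∃ ω : G.edgeSet → ℕ, G.IsWeighting 3 ω ∧ G.IsVertexColouring ω := by
  let W : Sym2 V → ℕ := Sym2.lift ⟨fun u v => (w u v).toNat, fun u v =>
    congrArg Int.toNat (hsymm u v)⟩
  have hW : ∀ u v, W s(u, v) = (w u v).toNat := fun u v => rfl
  have hdeg : ∀ v, ((G.weightedDegree (fun e => W e.val) v : ℕ) : ℤ)
      = ∑ x ∈ G.neighborFinset v, w v x := by
    intro v
    have h1 : G.weightedDegree (fun e => W e.val) v
        = ∑ x ∈ G.neighborFinset v, W s(v, x) := by
      unfold SimpleGraph.weightedDegree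
      symm
      refine Finset.sum_bij (fun x hx => ⟨s(v, x), by simpa using hx⟩) ?_ ?_ ?_ ?_
      · intro x hx
        simp
      · intro x hx y hy hxy
        exact Sym2.congr_right.1 (congrArg Subtype.val hxy)
      · rintro ⟨e, he⟩ hv
        have hv' : v ∈ e := by simpa using hv
        obtain ⟨x, rfl⟩ := Sym2.mem_iff_exists.1 hv'
        exact ⟨x, by simpa using he, rfl⟩
      · intro x hx
        rfl
    rw [h1]
    push_cast
    refine Finset.sum_congr rfl fun x hx => ?_
    have := (hw v x (by simpa using hx)).1
    rw [hW]
    omega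
  refine ⟨fun e => W e.val, ?_, ?_⟩
  · rintro ⟨e, he⟩
    induction e using Sym2.ind with
    | _ u v =>
      have := hw u v (by simpa using he)
      change 1 ≤ (w u v).toNat ∧ (w u v).toNat ≤ 3
      omega
  · intro u v huv heq
    apply hne u v huv
    rw [← hdeg, ← hdeg, heq]

/-! ### Dyadic blocks -/

/-- The block of a positive integer: every dyadic interval `[2 ^ k, 2 ^ (k + 1))` with `k ≥ 12` is
divided into `2 ^ 12` blocks of equal length. -/
def dyadicBlock (n : ℕ) : ℕ × ℕ := (Nat.log 2 n, n / 2 ^ (Nat.log 2 n - 12))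

/-- The length of the block of `n`. -/
def blockLength (n : ℕ) : ℕ := 2 ^ (Nat.log 2 n - 12)

/-- The integers in the block of `y` whose residue modulo `8` satisfies `p`. -/
def blockList (p : ℕ → Prop) [DecidablePred p] (y : ℕ) : Finset ℕ :=
  {t ∈ range (2 ^ (Nat.log 2 y + 1)) | dyadicBlock t = dyadicBlock y ∧ p (t % 8)}

theorem blockLength_pos (y : ℕ) : 0 < blockLength y := by unfold blockLength; positivity

theorem blockLength_le {y : ℕ} (hy : 2 ^ 12 ≤ y) : 2 ^ 12 * blockLength y ≤ y := by
  have h12 : 12 ≤ Nat.log 2 y := Nat.le_log_of_pow_le (by norm_num) hy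
  unfold blockLength
  rw [← pow_add, Nat.add_sub_cancel' h12]
  exact Nat.pow_log_le_self 2 (by omega)

theorem lt_blockLength {y : ℕ} (hy : 2 ^ 12 ≤ y) : y < 2 ^ 13 * blockLength y := by
  have h12 : 12 ≤ Nat.log 2 y := Nat.le_log_of_pow_le (by norm_num) hy
  unfold blockLength
  rw [← pow_add, show 13 + (Nat.log 2 y - 12) = (Nat.log 2 y).succ by omega]
  exact Nat.lt_pow_succ_log_self (by norm_num) y

theorem mem_Ico_of_dyadicBlock_eq {t y : ℕ} (h : dyadicBlock t = dyadicBlock y) :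
    blockLength y * (y / blockLength y) ≤ t ∧
      t < blockLength y * (y / blockLength y) + blockLength y := by
  unfold dyadicBlock at h
  rw [Prod.mk.injEq] at h
  obtain ⟨h1, h2⟩ := h
  rw [h1] at h2
  change t / blockLength y = y / blockLength y at h2
  rw [← h2]
  refine ⟨Nat.mul_div_le _ _, ?_⟩
  exact Nat.lt_mul_div_succ t (blockLength_pos y)

/-- From `2 ^ 12` on, the block length divides the power of two below `y`, so a block never crosses
a power of two and all its elements have the same logarithm. -/
theorem dyadicBlock_eq_of_mem_Ico {t y : ℕ} (hy : 2 ^ 12 ≤ y)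
    (h1 : blockLength y * (y / blockLength y) ≤ t)
    (h2 : t < blockLength y * (y / blockLength y) + blockLength y) :
    dyadicBlock t = dyadicBlock y ∧ t < 2 ^ (Nat.log 2 y + 1) := by
  have h12 : 12 ≤ Nat.log 2 y := Nat.le_log_of_pow_le (by norm_num) hy
  have hpos := blockLength_pos y
  have hk : 2 ^ 12 * blockLength y = 2 ^ Nat.log 2 y := by
    unfold blockLength
    rw [← pow_add, Nat.add_sub_cancel' h12]
  have hb1 : 2 ^ 12 ≤ y / blockLength y := (Nat.le_div_iff_mul_le hpos).2 (blockLength_le hy)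
  have hb2 : y / blockLength y < 2 ^ 13 := (Nat.div_lt_iff_lt_mul hpos).2 (lt_blockLength hy)
  have ht1 : 2 ^ Nat.log 2 y ≤ t := by
    rw [← hk]
    nlinarith
  have ht2 : t < 2 ^ (Nat.log 2 y + 1) := by
    rw [pow_succ, ← hk]
    nlinarith
  have hlog : Nat.log 2 t = Nat.log 2 y := Nat.log_eq_of_pow_le_of_lt_pow ht1 ht2
  refine ⟨?_, ht2⟩
  unfold dyadicBlock
  rw [hlog]
  change (_, t / blockLength y) = (_, y / blockLength y)
  rw [Nat.div_eq_of_lt_le (by rw [mul_comm]; exact h1)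
    (by rw [mul_comm, Nat.mul_add, Nat.mul_one]; exact h2)]

theorem eight_dvd_blockLength {y : ℕ} (hy : 2 ^ 15 ≤ y) : 8 ∣ blockLength y := by
  have h15 : 15 ≤ Nat.log 2 y := Nat.le_log_of_pow_le (by norm_num) hy
  exact pow_dvd_pow 2 (show 3 ≤ Nat.log 2 y - 12 by omega)

/-- From `2 ^ 15` on, the block length is a multiple of 8, and so is the start of the block; every
residue modulo 8 thus occupies exactly one eighth of it. -/
theorem blockLength_le_card_blockList {y : ℕ} (hy : 2 ^ 15 ≤ y) :
    blockLength y ≤ 8 * #(blockList (fun r => r = 0) y) := by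
  obtain ⟨m, hm⟩ := eight_dvd_blockLength hy
  have hcard : #((range m).image fun j => blockLength y * (y / blockLength y) + 8 * j) = m := by
    rw [Finset.card_image_of_injective _ fun i j hij => by simpa using hij, Finset.card_range]
  have hsub : ((range m).image fun j => blockLength y * (y / blockLength y) + 8 * j)
      ⊆ blockList (fun r => r = 0) y := by
    intro t ht
    obtain ⟨j, hj, rfl⟩ := Finset.mem_image.1 ht
    rw [Finset.mem_range] at hj
    obtain ⟨h1, h2⟩ := dyadicBlock_eq_of_mem_Ico (y := y)
      (t := blockLength y * (y / blockLength y) + 8 * j)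
      (by omega) (by omega) (by omega)
    refine Finset.mem_filter.2 ⟨Finset.mem_range.2 h2, h1, ?_⟩
    rw [hm, mul_assoc]
    omega
  have := Finset.card_le_card hsub
  omega

theorem five_mul_blockLength_le_card_blockList {y : ℕ} (hy : 2 ^ 15 ≤ y) :
    5 * blockLength y ≤ 8 * #(blockList (fun r => 3 ≤ r) y) := by
  obtain ⟨m, hm⟩ := eight_dvd_blockLength hy
  set f : ℕ × ℕ → ℕ := fun p => blockLength y * (y / blockLength y) + 8 * p.1 + 3 + p.2 with hf
  have hcard : #((range m ×ˢ range 5).image f) = m * 5 := by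
    rw [Finset.card_image_of_injOn, Finset.card_product, Finset.card_range, Finset.card_range]
    rintro ⟨i, j⟩ h ⟨i', j'⟩ h' heq
    simp only [coe_product, coe_range, Set.mem_prod, Set.mem_Iio] at h h'
    simp only [hf] at heq
    ext <;> dsimp only <;> omega
  have hsub : ((range m ×ˢ range 5).image f) ⊆ blockList (fun r => 3 ≤ r) y := by
    intro t ht
    obtain ⟨⟨i, j⟩, hij, rfl⟩ := Finset.mem_image.1 ht
    simp only [Finset.mem_product, Finset.mem_range] at hij
    obtain ⟨h1, h2⟩ := dyadicBlock_eq_of_mem_Ico (y := y) (t := f (i, j)) (by omega)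
      (by simp only [hf]; omega) (by simp only [hf]; omega)
    refine Finset.mem_filter.2 ⟨Finset.mem_range.2 h2, h1, ?_⟩
    simp only [hf]
    rw [hm, mul_assoc]
    omega
  have := Finset.card_le_card hsub
  omega

/-! ### The weighting built from classes and targets -/

/-- Vertices of the classes `0, 1` are treated last, with the help of those of class `3, 2`,
respectively. The vertices of class `2, 3, 4` get their sums in the blocks of prescribed values by
changing the edges towards the vertices of class `0, 1, 0`, respectively. -/
theorem exists_weighting_of_classes {V : Type*} [Fintype V] [DecidableEq V] (G : SimpleGraph V)
    [DecidableRel G.Adj] (cls : V → ℕ) (hcls : ∀ v, cls v ≤ 4) (w₀ : V → V → ℤ)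
    (hsymm : ∀ u v, w₀ u v = w₀ v u) (hw₀ : ∀ u v, 1 ≤ w₀ u v ∧ w₀ u v ≤ 3)
    (hw₂ : ∀ u v, cls v < 2 → w₀ u v = 2) (y : V → ℕ) (hy : ∀ v, 2 ^ 15 ≤ y v)
    (hown : ∀ v, 2 ≤ cls v → |(∑ u ∈ G.neighborFinset v, w₀ v u) - y v| + blockLength (y v)
      ≤ #{u ∈ G.neighborFinset v | cls u = if cls v = 3 then 1 else 0})
    (hA : ∀ v, 8 * #{u ∈ G.neighborFinset v |
      G.degree v ≤ G.degree u ∧ dyadicBlock (y u) = dyadicBlock (y v)} < 5 * blockLength (y v))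
    (hB : ∀ v, 8 * #{u ∈ G.neighborFinset v | G.degree v ≤ G.degree u ∧
      dyadicBlock (y u) = dyadicBlock (y v) ∧ (cls u = 2 ∨ cls u = 3)} < blockLength (y v))
    (hΛ : ∀ v, cls v < 2 → 8 * (#{u ∈ G.neighborFinset v | cls u < 2} + 1)
      ≤ #{u ∈ G.neighborFinset v | cls u = 3 - cls v}) :
    ∃ ω : G.edgeSet → ℕ, G.IsWeighting 3 ω ∧ G.IsVertexColouring ω := by
  classical
  let r : V → V → Prop := fun u v => G.Adj u v ∧ dyadicBlock (y u) = dyadicBlock (y v) ∧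
    ((cls u = 4 ∧ cls v = 4) ∨ ((cls u = 2 ∨ cls u = 3) ∧ (cls v = 2 ∨ cls v = 3)))
  -- Classes 0 and 1 get no target; their list `{0}` is a dummy, as `r` never relates them to
  -- anything.
  let L : V → Finset ℕ := fun v => if cls v < 2 then {0} else
    if cls v = 4 then blockList (fun r => 3 ≤ r) (y v) else blockList (fun r => r = 0) (y v)
  obtain ⟨t, htL, htr⟩ := exists_list_colouring r
    (fun u v h => ⟨h.1.symm, h.2.1.symm, by tauto⟩) (fun v => G.degree v) L (by
      intro v
      have h4 := hcls v
      by_cases h1 : cls v < 2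
      · have : (univ.filter fun u => r v u ∧ G.degree v ≤ G.degree u) = ∅ := by
          rw [Finset.filter_eq_empty_iff]
          rintro u - ⟨⟨-, -, h⟩, -⟩
          omega
        rw [this]
        simp only [L, if_pos h1]
        simp
      · by_cases h2 : cls v = 4
        · have hsub : (univ.filter fun u => r v u ∧ G.degree v ≤ G.degree u)
              ⊆ {u ∈ G.neighborFinset v |
                G.degree v ≤ G.degree u ∧ dyadicBlock (y u) = dyadicBlock (y v)} := by
            intro u hu
            obtain ⟨⟨ha, hb, -⟩, hd⟩ := (Finset.mem_filter.1 hu).2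
            exact Finset.mem_filter.2 ⟨by simpa using ha, hd, hb.symm⟩
          have hc := Finset.card_le_card hsub
          have hl := five_mul_blockLength_le_card_blockList (hy v)
          have := hA v
          simp only [L, if_neg h1, if_pos h2]
          omega
        · have hsub : (univ.filter fun u => r v u ∧ G.degree v ≤ G.degree u)
              ⊆ {u ∈ G.neighborFinset v | G.degree v ≤ G.degree u ∧
                dyadicBlock (y u) = dyadicBlock (y v) ∧ (cls u = 2 ∨ cls u = 3)} := by
            intro u hu
            obtain ⟨⟨ha, hb, hc⟩, hd⟩ := (Finset.mem_filter.1 hu).2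
            exact Finset.mem_filter.2 ⟨by simpa using ha, hd, hb.symm, by omega⟩
          have hc := Finset.card_le_card hsub
          have hl := blockLength_le_card_blockList (hy v)
          have := hB v
          simp only [L, if_neg h1, if_neg h2]
          omega)
  have ht : ∀ v, 2 ≤ cls v → dyadicBlock (t v) = dyadicBlock (y v) ∧
      (cls v = 4 → 3 ≤ t v % 8) ∧ (cls v ≠ 4 → t v % 8 = 0) := by
    intro v hv
    have h := htL v
    simp only [L, if_neg (show ¬ cls v < 2 by omega)] at h
    split_ifs at h with h4
    · have h := (Finset.mem_filter.1 h).2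
      exact ⟨h.1, fun _ => h.2, fun h' => absurd h4 h'⟩
    · have h := (Finset.mem_filter.1 h).2
      exact ⟨h.1, fun h' => absurd h' h4, fun _ => h.2⟩
  let T : V → Finset V := fun v => if 2 ≤ cls v then
    {u ∈ G.neighborFinset v | cls u = if cls v = 3 then 1 else 0} else ∅
  have hTN : ∀ v, T v ⊆ G.neighborFinset v := by
    intro v
    by_cases hv : 2 ≤ cls v
    · simp only [T, if_pos hv]
      exact Finset.filter_subset _ _
    · simp only [T, if_neg hv]
      exact Finset.empty_subset _
  have hchange : ∀ v, ∃ a : V → ℤ, (∀ u, |a u| ≤ 1) ∧ (∀ u, u ∉ T v → a u = 0) ∧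
      (2 ≤ cls v → ∑ u ∈ G.neighborFinset v, a u
        = t v - ∑ u ∈ G.neighborFinset v, w₀ v u) := by
    intro v
    by_cases hv : 2 ≤ cls v
    · obtain ⟨a, h1, h2, h3⟩ := exists_unit_changes (T v)
        -- Target and prescribed value share a block, so they differ by less than its length, which
        -- `hown` allows for.
        ((t v : ℤ) - ∑ u ∈ G.neighborFinset v, w₀ v u) (by
          have h := hown v hv
          have hy1 := mem_Ico_of_dyadicBlock_eq (ht v hv).1
          have hy2 := mem_Ico_of_dyadicBlock_eq (rfl : dyadicBlock (y v) = dyadicBlock (y v))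
          simp only [T, if_pos hv]
          generalize (∑ u ∈ G.neighborFinset v, w₀ v u) = s at h ⊢
          have habs : |(t v : ℤ) - y v| ≤ blockLength (y v) := by
            rw [abs_le]
            omega
          have := abs_sub_le (t v : ℤ) (y v) s
          rw [abs_sub_comm (y v : ℤ) s] at this
          omega)
      exact ⟨a, h1, h2, fun _ => h3 _ (hTN v)⟩
    · exact ⟨fun _ => 0, by simp, by simp, fun h => absurd h hv⟩
  choose a ha1 ha2 ha3 using hchange
  have haT : ∀ u v, a u v = 0 ∨ ((cls u = 2 ∧ cls v = 0) ∨ (cls u = 3 ∧ cls v = 1) ∨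
      (cls u = 4 ∧ cls v = 0)) := by
    intro u v
    by_cases h : v ∈ T u
    · right
      have h4 := hcls u
      by_cases h1 : 2 ≤ cls u
      · simp only [T, if_pos h1] at h
        have h := (Finset.mem_filter.1 h).2
        by_cases h3 : cls u = 3
        · simp only [if_pos h3] at h
          omega
        · simp only [if_neg h3] at h
          omega
      · simp [T, h1] at h
    · exact Or.inl (ha2 u v h)
  let Λ : Finset V := {v | cls v < 2}
  have hmΛ : ∀ v, v ∈ Λ ↔ cls v < 2 := fun v => by simp [Λ]
  let H : V → Finset V := fun v => {u ∈ G.neighborFinset v | cls u = 3 - cls v}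
  let s : V → ℤ := fun v => ∑ u ∈ G.neighborFinset v, (2 + a u v)
  obtain ⟨τ, hτ1, hτ2, hτ3, hτ4, hτ5⟩ := exists_toggling G.Adj (fun u v h => h.symm) Λ H s (by
    intro v hv
    have h := hΛ v ((hmΛ v).1 hv)
    have heq : (Λ.filter fun u => G.Adj v u) = {u ∈ G.neighborFinset v | cls u < 2} := by
      ext u
      simp [Λ, and_comm]
    rw [heq]
    exact h)
  have hτH : ∀ u v, τ u v = 0 ∨ (G.Adj u v ∧ ((cls u = 3 ∧ cls v = 0) ∨
      (cls u = 2 ∧ cls v = 1))) := by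
    intro u v
    by_cases hv : cls v < 2
    · by_cases hu : u ∈ H v
      · right
        obtain ⟨h1, h2⟩ := Finset.mem_filter.1 hu
        refine ⟨SimpleGraph.Adj.symm (by simpa using h1), by omega⟩
      · exact Or.inl (hτ2 u v (Or.inr hu))
    · exact Or.inl (hτ2 u v (Or.inl fun h => hv ((hmΛ v).1 h)))
  -- `a` acts on class pairs 2–0, 3–1, 4–0 and `τ` on 3–0, 2–1. These pairs are distinct and each
  -- contains a class below 2, so a changed edge starts at 2 and moves at most once.
  let w : V → V → ℤ := fun u v => w₀ u v + a u v + a v u + τ u v + τ v u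
  have hsum : ∀ v, ∑ x ∈ G.neighborFinset v, w v x
      = ∑ x ∈ G.neighborFinset v, w₀ v x + ∑ x ∈ G.neighborFinset v, a v x
        + ∑ x ∈ G.neighborFinset v, a x v + ∑ x, τ v x + ∑ x, τ x v := by
    intro v
    simp only [w, Finset.sum_add_distrib]
    congr 1
    · congr 1
      apply Finset.sum_subset (Finset.subset_univ _)
      intro x _ hx
      rcases hτH v x with h | h
      · exact h
      · exact absurd (by simpa using h.1) hx
    · apply Finset.sum_subset (Finset.subset_univ _)
      intro x _ hx
      rcases hτH x v with h | h
      · exact h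
      · exact absurd (by simpa using h.1.symm) hx
  have hlow : ∀ v, cls v < 2 → ∑ x ∈ G.neighborFinset v, w v x = s v + ∑ u, τ u v := by
    intro v hv
    rw [hsum]
    have e1 : ∑ x ∈ G.neighborFinset v, a v x = 0 :=
      Finset.sum_eq_zero fun x _ => by have := haT v x; omega
    have e2 : ∑ x, τ v x = 0 := Finset.sum_eq_zero fun x _ => by have := hτH v x; omega
    have e3 : s v = ∑ x ∈ G.neighborFinset v, w₀ v x + ∑ x ∈ G.neighborFinset v, a x v := by
      simp only [s, Finset.sum_add_distrib]
      congr 1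
      exact Finset.sum_congr rfl fun x _ => by rw [hsymm, hw₂ x v hv]
    rw [e1, e2, e3]
    ring
  have hhigh : ∀ v, 2 ≤ cls v → ∑ x ∈ G.neighborFinset v, w v x = t v + ∑ x, τ v x := by
    intro v hv
    rw [hsum]
    have e1 : ∑ x ∈ G.neighborFinset v, a x v = 0 :=
      Finset.sum_eq_zero fun x _ => by have := haT x v; omega
    have e2 : ∑ x, τ x v = 0 := Finset.sum_eq_zero fun x _ => by have := hτH x v; omega
    rw [e1, e2, ha3 v hv]
    ring
  have hlow8 : ∀ v, cls v < 2 → (∑ x ∈ G.neighborFinset v, w v x) % 8 = 2 := by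
    intro v hv
    rw [hlow v hv]
    exact hτ4 v ((hmΛ v).2 hv)
  have hhigh8 : ∀ v, 2 ≤ cls v → (cls v = 4 ∧ ∑ x ∈ G.neighborFinset v, w v x = t v ∧
      3 ≤ (t v : ℤ) % 8) ∨ ((cls v = 2 ∨ cls v = 3) ∧ (t v : ℤ) % 8 = 0 ∧
        (∑ x ∈ G.neighborFinset v, w v x = t v ∨ ∑ x ∈ G.neighborFinset v, w v x = t v + 1)) := by
    intro v hv
    rw [hhigh v hv]
    have h4 := hcls v
    obtain ⟨-, h1, h2⟩ := ht v hv
    by_cases hv4 : cls v = 4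
    · have e : ∑ x, τ v x = 0 := Finset.sum_eq_zero fun x _ => by have := hτH v x; omega
      left
      have := h1 hv4
      omega
    · have := h2 hv4
      have := hτ3 v
      omega
  refine exists_weighting_of_symm G w (fun u v => ?_) (fun u v _ => ?_) (fun u v huv heq => ?_)
  · simp only [w]
    rw [hsymm u v]
    ring
  · have b1 := abs_le.1 (ha1 u v)
    have b2 := abs_le.1 (ha1 v u)
    have b3 := abs_le.1 (hτ1 u v)
    have b4 := abs_le.1 (hτ1 v u)
    have c1 := haT u v
    have c2 := haT v u
    have c3 := (hτH u v).imp_right And.right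
    have c4 := (hτH v u).imp_right And.right
    have d1 := hw₀ u v
    have d2 := hw₂ u v
    have d3 : cls u < 2 → w₀ u v = 2 := fun h => by rw [hsymm]; exact hw₂ v u h
    simp only [w]
    omega
  · rcases Nat.lt_or_ge (cls u) 2 with hu | hu <;> rcases Nat.lt_or_ge (cls v) 2 with hv | hv
    · rw [hlow u hu, hlow v hv] at heq
      exact hτ5 u ((hmΛ u).2 hu) v ((hmΛ v).2 hv) huv.ne huv heq
    · have h1 := hlow8 u hu
      have h2 := hhigh8 v hv
      omega
    · have h1 := hlow8 v hv
      have h2 := hhigh8 u hu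
      omega
    -- Equal targets would lie in a common block, where the greedy colouring has separated them. For
    -- classes 2 and 3, distinct multiples of 8 stay distinct after adding 0 or 1.
    · have hne : ((cls u = 4 ∧ cls v = 4) ∨ ((cls u = 2 ∨ cls u = 3) ∧
          (cls v = 2 ∨ cls v = 3))) → t u ≠ t v := by
        intro hc heqt
        refine htr u v huv.ne ⟨huv, ?_, hc⟩ heqt
        rw [← (ht u hu).1, ← (ht v hv).1, heqt]
      have h1 := hhigh8 u hu
      have h2 := hhigh8 v hv
      omega

/-! ### Labels and the means of their statistics -/

/-- The class of a vertex whose label has second component `c`. -/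
def labelClass (c : Fin 512) : ℕ :=
  -- Class sizes 1, 1, 32, 32, 446. One label in 512 gives enough edges to cross a block; 32 exceeds
  -- 8 · 2, as toggling requires; 32 + 32 is one eighth of 512, keeping helper competition near
  -- L/16.
  if c.1 < 1 then 0 else if c.1 < 2 then 1 else if c.1 < 34 then 2 else if c.1 < 66 then 3 else 4

/-- The initial weight of an edge whose ends have the labels `z` and `z'`. -/
def labelWeight {N : ℕ} (z z' : Fin N × Fin 512) : ℕ :=
  if labelClass z.2 < 2 ∨ labelClass z'.2 < 2 then 2
  else if N ≤ (z.1 : ℕ) + z'.1 then 3 else 1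

/-- The integer part of the expected initial sum at a vertex of degree `d` whose label has first
component `x` and whose class is at least `2`. -/
def labelSum (N d x : ℕ) : ℕ := d * (257 * N + 510 * x) / (256 * N)

/-- The quantities whose sums over neighbourhoods are to be concentrated: `d` is the degree of the
centre, `e` that of the neighbour, and `a` is the label of the neighbour. -/
noncomputable def labelStat (N d e : ℕ) :
    (Fin N × Fin 512) × Fin 3 ⊕ Fin 5 → Fin N × Fin 512 → ℝ
  | .inl (z, 0), a => labelWeight z a / 3
  | .inl (z, 1), a =>
    if d ≤ e ∧ dyadicBlock (labelSum N e a.1) = dyadicBlock (labelSum N d z.1) then 1 else 0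
  | .inl (z, 2), a =>
    if d ≤ e ∧ dyadicBlock (labelSum N e a.1) = dyadicBlock (labelSum N d z.1) ∧
      (labelClass a.2 = 2 ∨ labelClass a.2 = 3) then 1 else 0
  | .inr i, a => if labelClass a.2 = i then 1 else 0

theorem labelClass_le (c : Fin 512) : labelClass c ≤ 4 := by
  unfold labelClass
  split_ifs <;> omega

theorem labelWeight_comm {N : ℕ} (z z' : Fin N × Fin 512) :
    labelWeight z z' = labelWeight z' z := by
  unfold labelWeight
  split_ifs <;> omega

theorem one_le_labelWeight {N : ℕ} (z z' : Fin N × Fin 512) : 1 ≤ labelWeight z z' := by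
  unfold labelWeight
  split_ifs <;> omega

theorem labelWeight_le {N : ℕ} (z z' : Fin N × Fin 512) : labelWeight z z' ≤ 3 := by
  unfold labelWeight
  split_ifs <;> omega

theorem labelStat_mem_Icc {N d e : ℕ} (k : (Fin N × Fin 512) × Fin 3 ⊕ Fin 5)
    (a : Fin N × Fin 512) : 0 ≤ labelStat N d e k a ∧ labelStat N d e k a ≤ 1 := by
  rcases k with ⟨z, i⟩ | i
  · fin_cases i
    · have h : (labelWeight z a : ℝ) ≤ 3 := by exact_mod_cast labelWeight_le z a
      have h0 : (0 : ℝ) ≤ labelWeight z a := by positivity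
      change 0 ≤ (labelWeight z a : ℝ) / 3 ∧ (labelWeight z a : ℝ) / 3 ≤ 1
      constructor <;> linarith
    · simp only [labelStat]
      split_ifs <;> norm_num
    · simp only [labelStat]
      split_ifs <;> norm_num
  · simp only [labelStat]
    split_ifs <;> norm_num

theorem card_fin_filter_of_iff_mem_Ico {n : ℕ} (p : Fin n → Prop) [DecidablePred p] {a b : ℕ}
    (hb : b ≤ n) (h : ∀ c, p c ↔ a ≤ (c : ℕ) ∧ (c : ℕ) < b) : #{c | p c} = b - a := by
  rw [← Finset.card_map Fin.valEmbedding, ← Nat.card_Ico]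
  congr 1
  ext i
  simp only [mem_map, mem_filter_univ, Fin.valEmbedding_apply, mem_Ico, h]
  constructor
  · rintro ⟨c, hc, rfl⟩
    exact hc
  · rintro ⟨h1, h2⟩
    exact ⟨⟨i, h2.trans_le hb⟩, ⟨h1, h2⟩, rfl⟩

theorem card_labelClass_lt_two : #{c | labelClass c < 2} = 2 :=
  card_fin_filter_of_iff_mem_Ico (a := 0) (b := 2) _ (by norm_num) fun c => by
    grind [labelClass]

theorem card_labelClass_eq_zero : #{c | labelClass c = 0} = 1 :=
  card_fin_filter_of_iff_mem_Ico (a := 0) (b := 1) _ (by norm_num) fun c => by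
    grind [labelClass]

theorem card_labelClass_eq_one : #{c | labelClass c = 1} = 1 :=
  card_fin_filter_of_iff_mem_Ico (a := 1) (b := 2) _ (by norm_num) fun c => by
    grind [labelClass]

theorem card_labelClass_eq_two : #{c | labelClass c = 2} = 32 :=
  card_fin_filter_of_iff_mem_Ico (a := 2) (b := 34) _ (by norm_num) fun c => by
    grind [labelClass]

theorem card_labelClass_eq_three : #{c | labelClass c = 3} = 32 :=
  card_fin_filter_of_iff_mem_Ico (a := 34) (b := 66) _ (by norm_num) fun c => by
    grind [labelClass]

theorem card_labelClass_eq_two_or_three : #{c | labelClass c = 2 ∨ labelClass c = 3} = 64 :=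
  card_fin_filter_of_iff_mem_Ico (a := 2) (b := 66) _ (by norm_num) fun c => by
    grind [labelClass]

theorem le_labelSum {N d x : ℕ} (hN : 0 < N) : d ≤ labelSum N d x := by
  unfold labelSum
  rw [Nat.le_div_iff_mul_le (by positivity)]
  exact Nat.mul_le_mul_left d (by omega)

theorem labelSum_le {N d x : ℕ} (hx : x < N) : labelSum N d x ≤ 3 * d := by
  unfold labelSum
  apply Nat.div_le_of_le_mul
  calc d * (257 * N + 510 * x) ≤ d * (768 * N) := Nat.mul_le_mul_left d (by omega)
    _ = 256 * N * (3 * d) := by ring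

theorem abs_labelSum_sub_le {N : ℕ} (hN : 0 < N) (d x : ℕ) :
    |(labelSum N d x : ℝ) - d * (257 * N + 510 * x) / (256 * N)| ≤ 1 := by
  have hD : (0 : ℝ) < 256 * N := by positivity
  have h1 : labelSum N d x * (256 * N) ≤ d * (257 * N + 510 * x) := Nat.div_mul_le_self _ _
  have h2 : d * (257 * N + 510 * x) < (labelSum N d x + 1) * (256 * N) :=
    (Nat.div_lt_iff_lt_mul (by positivity)).1 (Nat.lt_succ_self _)
  have h1' : (labelSum N d x : ℝ) * (256 * N) ≤ d * (257 * N + 510 * x) := by exact_mod_cast h1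
  have h2' : (d : ℝ) * (257 * N + 510 * x) < (labelSum N d x + 1) * (256 * N) := by
    exact_mod_cast h2
  have h3 := (le_div_iff₀ hD).2 h1'
  have h4 := (div_lt_iff₀ hD).2 h2'
  rw [abs_le]
  constructor <;> linarith

/-- Exactly `z.1` of the `N` positions reach the threshold, so the 510 classes-above-1 labels
average 1 + 2x/N with x = `z.1`; the other two contribute weight 2. -/
theorem sum_labelWeight {N : ℕ} (z : Fin N × Fin 512) (hz : 2 ≤ labelClass z.2) :
    ∑ a, labelWeight z a = 2 * (257 * N + 510 * z.1) := by
  have hx : ∑ x : Fin N, (if N ≤ (z.1 : ℕ) + x then 3 else 1) = N + 2 * (z.1 : ℕ) := by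
    have hc : #{x : Fin N | N ≤ (z.1 : ℕ) + x} = z.1 := by
      have hz1 := z.1.2
      rw [card_fin_filter_of_iff_mem_Ico (a := N - z.1) _ le_rfl fun x => by omega]
      omega
    have : ∀ x : Fin N, (if N ≤ (z.1 : ℕ) + x then 3 else 1)
        = 1 + 2 * (if N ≤ (z.1 : ℕ) + x then 1 else 0) := fun x => by split_ifs <;> rfl
    rw [Finset.sum_congr rfl fun x _ => this x, Finset.sum_add_distrib, ← Finset.mul_sum,
      Finset.sum_boole, hc]
    simp
  have hc : ∀ c, ∑ x : Fin N, labelWeight z (x, c)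
      = if labelClass c < 2 then 2 * N else N + 2 * (z.1 : ℕ) := by
    intro c
    by_cases h : labelClass c < 2
    · simp [labelWeight, h, mul_comm]
    · simp only [labelWeight, h, show ¬ labelClass z.2 < 2 by omega, or_self, if_false]
      exact hx
  rw [Fintype.sum_prod_type_right, Finset.sum_congr rfl fun c _ => hc c, Finset.sum_ite,
    Finset.sum_const, Finset.sum_const, card_labelClass_lt_two]
  have h1 := Finset.card_filter_add_card_filter_not (s := (univ : Finset (Fin 512)))
    (fun c => labelClass c < 2)
  rw [card_labelClass_lt_two, Finset.card_univ, Fintype.card_fin] at h1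
  rw [show #{c | ¬ labelClass c < 2} = 510 by omega]
  simp only [smul_eq_mul]
  ring

theorem mul_card_le_of_forall_lt {S : Finset ℕ} {s L : ℕ}
    (h : ∀ x ∈ S, ∀ x' ∈ S, s * x < s * x' + L) : s * #S ≤ L + s := by
  rcases S.eq_empty_or_nonempty with rfl | hS
  · simp
  have hsub : S ⊆ Icc (S.min' hS) (S.max' hS) := fun x hx =>
    Finset.mem_Icc.2 ⟨S.min'_le x hx, S.le_max' x hx⟩
  have hc := Finset.card_le_card hsub
  rw [Nat.card_Icc] at hc
  have h1 := h _ (S.max'_mem hS) _ (S.min'_mem hS)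
  have h2 : S.min' hS ≤ S.max' hS := S.min'_le _ (S.max'_mem hS)
  obtain ⟨m, hm⟩ := Nat.exists_eq_add_of_le h2
  rw [hm] at hc h1
  have h3 : s * #S ≤ s * (m + 1) := Nat.mul_le_mul_left s (by omega)
  nlinarith

/-- Before rounding down, the expected sum grows by 510e/(256N) per position, so a block of length L
catches at most 256NL/(510e) + 1 positions. -/
theorem card_dyadicBlock_labelSum_eq_le {N : ℕ} (hN : 0 < N) (e y : ℕ) :
    510 * e * #{x : Fin N | dyadicBlock (labelSum N e x) = dyadicBlock y}
      ≤ 256 * N * blockLength y + 510 * e := by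
  rw [← Finset.card_map Fin.valEmbedding]
  apply mul_card_le_of_forall_lt
  intro x hx x' hx'
  obtain ⟨x, hxy, rfl⟩ := Finset.mem_map.1 hx
  obtain ⟨x', hxy', rfl⟩ := Finset.mem_map.1 hx'
  have h1 := mem_Ico_of_dyadicBlock_eq (Finset.mem_filter.1 hxy).2
  have h2 := mem_Ico_of_dyadicBlock_eq (Finset.mem_filter.1 hxy').2
  have h3 : labelSum N e x + 1 ≤ labelSum N e x' + blockLength y := by omega
  have h4 : labelSum N e x' * (256 * N) ≤ e * (257 * N + 510 * x') := Nat.div_mul_le_self _ _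
  have h5 : e * (257 * N + 510 * x) < (labelSum N e x + 1) * (256 * N) :=
    (Nat.div_lt_iff_lt_mul (by positivity)).1 (Nat.lt_succ_self _)
  have h6 := Nat.mul_le_mul_right (256 * N) h3
  simp only [Fin.valEmbedding_apply]
  linarith

theorem card_fin_prod_filter {N : ℕ} (p : Fin N → Prop) (q : Fin 512 → Prop) [DecidablePred p]
    [DecidablePred q] :
    #{a : Fin N × Fin 512 | p a.1 ∧ q a.2} = #{x | p x} * #{c | q c} := by
  rw [← Finset.card_product]
  congr 1
  ext a
  simp

theorem mean_labelStat_weight {N : ℕ} (d e : ℕ) (z : Fin N × Fin 512)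
    (hz : 2 ≤ labelClass z.2) :
    (∑ a, labelStat N d e (.inl (z, 0)) a) / Fintype.card (Fin N × Fin 512)
      = (257 * N + 510 * z.1) / (256 * N) / 3 := by
  have h : (∑ a, (labelWeight z a : ℝ)) = 2 * (257 * N + 510 * z.1) := by
    exact_mod_cast sum_labelWeight z hz
  simp only [labelStat]
  rw [← Finset.sum_div, h, Fintype.card_prod, Fintype.card_fin, Fintype.card_fin]
  push_cast
  have hN : (N : ℝ) ≠ 0 := by
    have := z.1.2
    have : 0 < N := by omega
    positivity
  field_simp
  ring

theorem mean_labelStat_class {N : ℕ} (hN : 0 < N) (d e : ℕ) (i : Fin 5) :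
    (∑ a, labelStat N d e (.inr i) a) / Fintype.card (Fin N × Fin 512)
      = (#{c | labelClass c = i} : ℝ) / 512 := by
  have hN : (N : ℝ) ≠ 0 := by positivity
  have h := card_fin_prod_filter (N := N) (fun _ => True) (fun c => labelClass c = i)
  simp only [true_and, Finset.filter_true, Finset.card_univ, Fintype.card_fin] at h
  simp only [labelStat]
  rw [Finset.sum_boole, h, Fintype.card_prod, Fintype.card_fin, Fintype.card_fin]
  generalize #{c | labelClass c = i} = n
  push_cast
  field_simp

/-- Larger degrees spread their expected sums more thinly. This is why a vertex can afford to
compete only with neighbours of at least its own degree. -/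
theorem card_dyadicBlock_div_le {N : ℕ} (hN : 0 < N) {d e : ℕ} (hd : 0 < d) (hde : d ≤ e) (y : ℕ) :
    (#{x : Fin N | dyadicBlock (labelSum N e x) = dyadicBlock y} : ℝ) / N
      ≤ 128 * blockLength y / (255 * d) + 1 / N := by
  have hN0 : (0 : ℝ) < N := by positivity
  have hd0 : (0 : ℝ) < d := by positivity
  have hde0 : (d : ℝ) ≤ e := by exact_mod_cast hde
  have he0 : (0 : ℝ) < e := by linarith
  have h : (510 * e * #{x : Fin N | dyadicBlock (labelSum N e x) = dyadicBlock y} : ℝ)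
      ≤ 256 * N * blockLength y + 510 * e := by
    exact_mod_cast card_dyadicBlock_labelSum_eq_le hN e y
  have h2 : (128 * blockLength y / (255 * e) : ℝ) ≤ 128 * blockLength y / (255 * d) := by gcongr
  refine le_trans ?_ (add_le_add_left h2 _)
  rw [div_le_iff₀ hN0]
  rw [show (128 * blockLength y / (255 * e) + 1 / N : ℝ) * N
    = (256 * N * blockLength y + 510 * e) / (510 * e) by field_simp; ring]
  rw [le_div_iff₀ (by positivity)]
  linarith

theorem mean_labelStat_block_le {N : ℕ} (hN : 0 < N) {d : ℕ} (hd : 0 < d) (e : ℕ)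
    (z : Fin N × Fin 512) :
    (∑ a, labelStat N d e (.inl (z, 1)) a) / Fintype.card (Fin N × Fin 512)
      ≤ 128 * blockLength (labelSum N d z.1) / (255 * d) + 1 / N := by
  have hN0 : (0 : ℝ) < N := by positivity
  by_cases hde : d ≤ e
  · have h := card_fin_prod_filter (N := N) (fun x => dyadicBlock (labelSum N e x)
      = dyadicBlock (labelSum N d z.1)) (fun _ => True)
    simp only [and_true, Finset.filter_true, Finset.card_univ, Fintype.card_fin] at h
    simp only [labelStat, hde, true_and]
    rw [Finset.sum_boole, h, Fintype.card_prod, Fintype.card_fin, Fintype.card_fin]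
    push_cast
    rw [mul_div_mul_right _ _ (by norm_num)]
    exact card_dyadicBlock_div_le hN hd hde _
  · simp only [labelStat, hde, false_and, if_false, Finset.sum_const_zero, zero_div]
    positivity

theorem mean_labelStat_block_class_le {N : ℕ} (hN : 0 < N) {d : ℕ} (hd : 0 < d) (e : ℕ)
    (z : Fin N × Fin 512) :
    (∑ a, labelStat N d e (.inl (z, 2)) a) / Fintype.card (Fin N × Fin 512)
      ≤ (128 * blockLength (labelSum N d z.1) / (255 * d) + 1 / N) / 8 := by
  have hN0 : (0 : ℝ) < N := by positivity
  by_cases hde : d ≤ e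
  · have h := card_fin_prod_filter (N := N) (fun x => dyadicBlock (labelSum N e x)
      = dyadicBlock (labelSum N d z.1)) (fun c => labelClass c = 2 ∨ labelClass c = 3)
    simp only [labelStat, hde, true_and]
    rw [Finset.sum_boole, h, Fintype.card_prod, Fintype.card_fin, Fintype.card_fin,
      card_labelClass_eq_two_or_three]
    push_cast
    have h1 := card_dyadicBlock_div_le hN hd hde (labelSum N d z.1)
    rw [show ∀ r : ℝ, r * 64 / (N * 512) = r / N / 8 by intro r; field_simp; ring]
    linarith
  · simp only [labelStat, hde, false_and, if_false, Finset.sum_const_zero, zero_div]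
    positivity

/-! ### Numerical verification and conclusion -/

/-- With d ≥ 2^15 and d/2^13 ≤ L ≤ 3d/2^12, every error term is small: the terms d/2^18 are at most
L/32, and rounding costs 1 ≤ d/2^15. -/
theorem exists_weighting_of_concentrated_labelling {V : Type*} [Fintype V] [DecidableEq V]
    (G : SimpleGraph V) [DecidableRel G.Adj] {N : ℕ} (hN : N = 2 ^ 18)
    (hδ : ∀ v, 2 ^ 15 ≤ G.degree v) (Z : V → Fin N × Fin 512)
    (hZ : ∀ v k, |∑ u ∈ G.neighborFinset v, labelStat N (G.degree v) (G.degree u) k (Z u)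
      - ∑ u ∈ G.neighborFinset v, (∑ a, labelStat N (G.degree v) (G.degree u) k a)
        / Fintype.card (Fin N × Fin 512)| ≤ (1 / 2 ^ 18 : ℝ) * G.degree v) :
    ∃ ω : G.edgeSet → ℕ, G.IsWeighting 3 ω ∧ G.IsVertexColouring ω := by
  have hN0 : 0 < N := by rw [hN]; positivity
  have hNR : (1 / N : ℝ) = 1 / 2 ^ 18 := by rw [hN]; norm_num
  let y : V → ℕ := fun v => labelSum N (G.degree v) (Z v).1
  have hdy : ∀ v, G.degree v ≤ y v := fun v => le_labelSum hN0
  have hyd : ∀ v, y v ≤ 3 * G.degree v := fun v => labelSum_le (Z v).1.2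
  have hy : ∀ v, 2 ^ 15 ≤ y v := fun v => (hδ v).trans (hdy v)
  have hdR : ∀ v, (2 ^ 15 : ℝ) ≤ G.degree v := fun v => by exact_mod_cast hδ v
  have hl1 : ∀ v, (G.degree v : ℝ) ≤ 2 ^ 13 * blockLength (y v) := fun v => by
    exact_mod_cast (hdy v).trans (lt_blockLength ((by norm_num : 2 ^ 12 ≤ 2 ^ 15).trans (hy v))).le
  have hl2 : ∀ v, (2 ^ 12 * blockLength (y v) : ℝ) ≤ 3 * G.degree v := fun v => by
    exact_mod_cast (blockLength_le ((by norm_num : 2 ^ 12 ≤ 2 ^ 15).trans (hy v))).trans (hyd v)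
  have hcl : ∀ v (i : Fin 5), |(#{u ∈ G.neighborFinset v | labelClass (Z u).2 = i} : ℝ)
      - G.degree v * (#{c | labelClass c = i} / 512)| ≤ (1 / 2 ^ 18 : ℝ) * G.degree v := by
    intro v i
    have h := hZ v (.inr i)
    rw [Finset.sum_congr rfl fun u _ => mean_labelStat_class hN0 (G.degree v) (G.degree u) i,
      Finset.sum_const, SimpleGraph.card_neighborFinset_eq_degree, nsmul_eq_mul] at h
    simp only [labelStat] at h
    rwa [Finset.sum_boole] at h
  have hcl0 : ∀ v, |(#{u ∈ G.neighborFinset v | labelClass (Z u).2 = 0} : ℝ)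
      - G.degree v * (1 / 512)| ≤ (1 / 2 ^ 18 : ℝ) * G.degree v := fun v => by
    have h := hcl v 0
    simpa only [Fin.val_zero, card_labelClass_eq_zero, Nat.cast_one] using h
  have hcl1 : ∀ v, |(#{u ∈ G.neighborFinset v | labelClass (Z u).2 = 1} : ℝ)
      - G.degree v * (1 / 512)| ≤ (1 / 2 ^ 18 : ℝ) * G.degree v := fun v => by
    have h := hcl v 1
    rw [show ((1 : Fin 5) : ℕ) = 1 from rfl, card_labelClass_eq_one] at h
    exact_mod_cast h
  have hcl2 : ∀ v, |(#{u ∈ G.neighborFinset v | labelClass (Z u).2 = 2} : ℝ)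
      - G.degree v * (32 / 512)| ≤ (1 / 2 ^ 18 : ℝ) * G.degree v := fun v => by
    have h := hcl v 2
    rw [show ((2 : Fin 5) : ℕ) = 2 from rfl, card_labelClass_eq_two] at h
    exact_mod_cast h
  have hcl3 : ∀ v, |(#{u ∈ G.neighborFinset v | labelClass (Z u).2 = 3} : ℝ)
      - G.degree v * (32 / 512)| ≤ (1 / 2 ^ 18 : ℝ) * G.degree v := fun v => by
    have h := hcl v 3
    rw [show ((3 : Fin 5) : ℕ) = 3 from rfl, card_labelClass_eq_three] at h
    exact_mod_cast h
  refine exists_weighting_of_classes G (fun v => labelClass (Z v).2) (fun v => labelClass_le _)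
    (fun u v => (labelWeight (Z u) (Z v) : ℤ)) (fun u v => by rw [labelWeight_comm])
    (fun u v => ⟨by exact_mod_cast one_le_labelWeight _ _, by exact_mod_cast labelWeight_le _ _⟩)
    (fun u v hv => by simp [labelWeight, hv]) y hy ?_ ?_ ?_ ?_
  · intro v hv
    have h := hZ v (.inl (Z v, 0))
    rw [Finset.sum_congr rfl fun u _ =>
      mean_labelStat_weight (G.degree v) (G.degree u) (Z v) hv,
      Finset.sum_const, SimpleGraph.card_neighborFinset_eq_degree, nsmul_eq_mul] at h
    simp only [labelStat] at h
    rw [← Finset.sum_div] at h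
    have h1 := abs_labelSum_sub_le hN0 (G.degree v) (Z v).1
    rw [mul_div_assoc] at h1
    change |(y v : ℝ) - _| ≤ 1 at h1
    generalize ((257 * N + 510 * (Z v).1 : ℝ) / (256 * N)) = μ at h h1
    have h2 := hcl0 v
    have h3 := hcl1 v
    have h4 := hdR v
    have h5 := hl2 v
    rw [abs_le] at h h1 h2 h3
    have key : |(∑ u ∈ G.neighborFinset v, (labelWeight (Z v) (Z u) : ℝ)) - y v|
        ≤ 3 * (1 / 2 ^ 18) * G.degree v + 1 := by
      rw [abs_le]
      constructor <;> linarith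
    -- In units of d/2^18, the need is at most 3 + 8 + 192 (deviation, rounding, block length) and
    -- the supply at least 512 - 1.
    have fin : ∀ n : ℕ, (G.degree v * (1 / 512) - (1 / 2 ^ 18) * G.degree v : ℝ) ≤ n →
        |(∑ u ∈ G.neighborFinset v, (labelWeight (Z v) (Z u) : ℤ)) - y v| + blockLength (y v)
          ≤ n := by
      intro n hn
      have : |(∑ u ∈ G.neighborFinset v, (labelWeight (Z v) (Z u) : ℝ)) - y v|
          + blockLength (y v) ≤ n := by linarith
      exact_mod_cast this
    by_cases hv3 : labelClass (Z v).2 = 3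
    · simp only [hv3, if_true]
      exact fin _ (by linarith)
    · simp only [hv3, if_false]
      exact fin _ (by linarith)
  · intro v
    have hd : 0 < G.degree v := lt_of_lt_of_le (by norm_num) (hδ v)
    have hdR0 : (0 : ℝ) < G.degree v := by positivity
    have h := (abs_le.1 (hZ v (.inl (Z v, 1)))).2
    have h1 := Finset.sum_le_card_nsmul (G.neighborFinset v) _ _ fun u _ =>
      mean_labelStat_block_le hN0 hd (G.degree u) (Z v)
    rw [SimpleGraph.card_neighborFinset_eq_degree, nsmul_eq_mul, mul_add, hNR,
      show (G.degree v : ℝ) * (128 * blockLength (labelSum N (G.degree v) (Z v).1)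
        / (255 * G.degree v)) = 128 / 255 * blockLength (y v) by
        change _ = (128 / 255 : ℝ) * blockLength (labelSum N (G.degree v) (Z v).1)
        field_simp] at h1
    have h2 : ∑ u ∈ G.neighborFinset v, labelStat N (G.degree v) (G.degree u) (.inl (Z v, 1)) (Z u)
        = #{u ∈ G.neighborFinset v | G.degree v ≤ G.degree u ∧
          dyadicBlock (y u) = dyadicBlock (y v)} := by
      simp only [labelStat]
      rw [Finset.sum_boole]
    rw [h2] at h
    have h3 := hl1 v
    have h4 : (0 : ℝ) < blockLength (y v) := by exact_mod_cast blockLength_pos _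
    -- The count is at most (128/255 + 2/32)L, below 5L/8.
    have : (8 * #{u ∈ G.neighborFinset v | G.degree v ≤ G.degree u ∧
          dyadicBlock (y u) = dyadicBlock (y v)} : ℝ) < 5 * blockLength (y v) := by
      linarith
    exact_mod_cast this
  · intro v
    have hd : 0 < G.degree v := lt_of_lt_of_le (by norm_num) (hδ v)
    have hdR0 : (0 : ℝ) < G.degree v := by positivity
    have h := (abs_le.1 (hZ v (.inl (Z v, 2)))).2
    have h1 := Finset.sum_le_card_nsmul (G.neighborFinset v) _ _ fun u _ =>
      mean_labelStat_block_class_le hN0 hd (G.degree u) (Z v)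
    rw [SimpleGraph.card_neighborFinset_eq_degree, nsmul_eq_mul, ← mul_div_assoc, mul_add, hNR,
      show (G.degree v : ℝ) * (128 * blockLength (labelSum N (G.degree v) (Z v).1)
        / (255 * G.degree v)) = 128 / 255 * blockLength (y v) by
        change _ = (128 / 255 : ℝ) * blockLength (labelSum N (G.degree v) (Z v).1)
        field_simp] at h1
    have h2 : ∑ u ∈ G.neighborFinset v, labelStat N (G.degree v) (G.degree u) (.inl (Z v, 2)) (Z u)
        = #{u ∈ G.neighborFinset v | G.degree v ≤ G.degree u ∧
          dyadicBlock (y u) = dyadicBlock (y v) ∧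
            (labelClass (Z u).2 = 2 ∨ labelClass (Z u).2 = 3)} := by
      simp only [labelStat]
      rw [Finset.sum_boole]
    rw [h2] at h
    have h3 := hl1 v
    have h4 : (0 : ℝ) < blockLength (y v) := by exact_mod_cast blockLength_pos _
    -- The count is at most ((128/255 + 1/32)/8 + 1/32)L, below L/8.
    have : (8 * #{u ∈ G.neighborFinset v | G.degree v ≤ G.degree u ∧
          dyadicBlock (y u) = dyadicBlock (y v) ∧
            (labelClass (Z u).2 = 2 ∨ labelClass (Z u).2 = 3)} : ℝ) < blockLength (y v) := by
      linarith
    exact_mod_cast this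
  · intro v hv
    have hsplit : #{u ∈ G.neighborFinset v | labelClass (Z u).2 < 2}
        ≤ #{u ∈ G.neighborFinset v | labelClass (Z u).2 = 0}
          + #{u ∈ G.neighborFinset v | labelClass (Z u).2 = 1} := by
      refine le_trans (Finset.card_le_card fun u hu => ?_) (Finset.card_union_le _ _)
      simp only [mem_union, mem_filter] at hu ⊢
      have : labelClass (Z u).2 = 0 ∨ labelClass (Z u).2 = 1 := by omega
      tauto
    have hsplitR : (#{u ∈ G.neighborFinset v | labelClass (Z u).2 < 2} : ℝ)
        ≤ #{u ∈ G.neighborFinset v | labelClass (Z u).2 = 0}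
          + #{u ∈ G.neighborFinset v | labelClass (Z u).2 = 1} := by exact_mod_cast hsplit
    have h0 := (abs_le.1 (hcl0 v)).2
    have h1 := (abs_le.1 (hcl1 v)).2
    have h2 := (abs_le.1 (hcl2 v)).1
    have h3 := (abs_le.1 (hcl3 v)).1
    have h4 := hdR v
    have fin : ∀ n : ℕ, (G.degree v * (32 / 512) - (1 / 2 ^ 18) * G.degree v : ℝ) ≤ n →
        8 * (#{u ∈ G.neighborFinset v | labelClass (Z u).2 < 2} + 1) ≤ n := by
      intro n hn
      have : (8 * (#{u ∈ G.neighborFinset v | labelClass (Z u).2 < 2} + 1) : ℝ) ≤ n := by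
        linarith
      exact_mod_cast this
    have hv01 : labelClass (Z v).2 = 0 ∨ labelClass (Z v).2 = 1 := by omega
    rcases hv01 with hv0 | hv0
    · simp only [hv0]
      exact fin _ (by linarith)
    · simp only [hv0]
      exact fin _ (by linarith)

theorem theorem1 :
    ∃ C : ℝ, ∀ (V : Type*) [Fintype V] [DecidableEq V] (G : SimpleGraph V) [DecidableRel G.Adj],
      2 ≤ G.maxDegree → C * Real.log (G.maxDegree : ℝ) ≤ (G.minDegree : ℝ) →
        ∃ ω : G.edgeSet → ℕ, G.IsWeighting 3 ω ∧ G.IsVertexColouring ω := by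
  obtain ⟨N, hN⟩ : ∃ N, N = 2 ^ 18 := ⟨_, rfl⟩
  have : NeZero N := ⟨by rw [hN]; positivity⟩
  obtain ⟨C, hC⟩ := exists_labelling_concentrated ((Fin N × Fin 512) × Fin 3 ⊕ Fin 5)
    (Fin N × Fin 512) (1 / 2 ^ 18) (by positivity) (by norm_num)
  -- Since `log Δ ≥ log 2`, the second term forces minimum degree at least `2 ^ 15`.
  refine ⟨max C (2 ^ 15 / Real.log 2), fun V _ _ G _ hΔ hδ => ?_⟩
  have hlog2 : 0 < Real.log 2 := Real.log_pos (by norm_num)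
  have hlog : Real.log 2 ≤ Real.log G.maxDegree :=
    Real.log_le_log (by norm_num) (by exact_mod_cast hΔ)
  have hδ1 : C * Real.log G.maxDegree ≤ G.minDegree :=
    (mul_le_mul_of_nonneg_right (le_max_left _ _) (hlog2.le.trans hlog)).trans hδ
  have hδ2 : (2 ^ 15 : ℝ) ≤ G.minDegree := calc
    (2 ^ 15 : ℝ) = 2 ^ 15 / Real.log 2 * Real.log 2 := by field_simp
    _ ≤ max C (2 ^ 15 / Real.log 2) * Real.log G.maxDegree :=
      mul_le_mul (le_max_right _ _) hlog hlog2.le (le_max_of_le_right (by positivity))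
    _ ≤ G.minDegree := hδ
  have hδ3 : 2 ^ 15 ≤ G.minDegree := by exact_mod_cast hδ2
  obtain ⟨Z, hZ⟩ := hC V G hΔ hδ1
    (fun v k u a => labelStat N (G.degree v) (G.degree u) k a)
    (fun v k u a => (labelStat_mem_Icc k a).1) (fun v k u a => (labelStat_mem_Icc k a).2)
  exact exists_weighting_of_concentrated_labelling G hN
    (fun v => hδ3.trans (G.minDegree_le_degree v)) Z hZ
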